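/- Let $B$ be a complex triangular $n\times n$ matrix, written as $B=D+N$ with $D$ diagonal and $N$ strictly triangular. Let $\gamma^->0$ and $\gamma^+>0$ be such that the strip $\{z\in\mathbb C:\ -\gamma^-<\operatorname{Re}z<\gamma^+\}$ is disjoint from the spectrum $\sigma(B)$, and put $\gamma=\gamma^-+\gamma^+$. Let $\|\cdot\|$ be the norm on $n\times n$ matrices induced by a norm on $\mathbb C^n$, and assume that $\|\operatorname{diag}(d_1,\dots,d_n)\|\le\max_i|d_i|$ for all $d_1,\dots,d_n\in\mathbb C$. For $t\ne0$ let $g_t(\lambda)=-e^{\lambda t}$ if $\operatorname{Re}\lambda>0$ and $t<0$, $g_t(\lambda)=e^{\lambda t}$ if $\operatorname{Re}\lambda<0$ and $t>0$, and $g_t(\lambda)=0$ for all other $\lambda$ with $\operatorname{Re}\lambda\neq0$. Let $$\mathcal G(B,t)=\frac1{2\pi i}\int_\Gamma g_t(\lambda)(\lambda\mathbf 1-B)^{-1}\,d\lambda,\qquad t\ne0,$$ be Green's function of the bounded solutions problem for $x'(t)=Bx(t)+f(t)$, where the contour $\Gamma$ consists of finitely many closed curves in $\{\operatorname{Re}\lambda\ne0\}\setminus\sigma(B)$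 and winds exactly once, in the positive direction, around each point of $\sigma(B)$. Then for every $t\neq0$ (and every such $\Gamma$) $$\|\mathcal G(B,t)\|\le\bigl(\theta(t)e^{-\gamma^-t}+\theta(-t)e^{\gamma^+t}\bigr)\sum_{k=0}^{n-1}\|N\|^k\,\frac{|t|^k\sqrt{\gamma|t|}\,e^{\gamma|t|/2}\,K_{-k-\frac12}\bigl(\tfrac12\gamma|t|\bigr)}{\sqrt\pi\,k!},$$ where $\theta(t)=1$ for $t>0$ and $\theta(t)=0$ for $t<0$, and $K_\nu(x)=\int_0^\infty e^{-x\cosh u}\cosh(\nu u)\,du$ $(x>0)$ is the modified Bessel function of the second kind. -/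

import Mathlib

namespace GreenBound

noncomputable section

/-- `exp_t^+(z)`: `e^{zt}` for `t > 0`, zero for `t < 0` (never used at `t = 0`). -/
def expPlus (t : ℝ) (z : ℂ) : ℂ := if 0 < t then Complex.exp (z * t) else 0

/-- `exp_t^-(z)`: zero for `t > 0`, `-e^{zt}` for `t < 0` (never used at `t = 0`). -/
def expMinus (t : ℝ) (z : ℂ) : ℂ := if t < 0 then -Complex.exp (z * t) else 0

/-- `g_t(z)`: `exp_t^-(z)` for `Re z > 0` and `exp_t^+(z)` for `Re z < 0`.
The value on the imaginary axis, where the function is undefined, is never used. -/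
def gFun (t : ℝ) (z : ℂ) : ℂ :=
  if 0 < z.re then expMinus t z else if z.re < 0 then expPlus t z else 0

/-- A closed curve in the plane, parametrized by `[0, 1]`: continuous, differentiable off a finite
set of parameters, with integrable derivative. Every closed piecewise `C¹` curve is of this kind. -/
structure ClosedCurve where
  toFun : ℝ → ℂ
  closed : toFun 0 = toFun 1
  continuousOn : ContinuousOn toFun (Set.Icc 0 1)
  differentiable :
    ∃ s : Set ℝ, s.Finite ∧ ∀ x ∈ Set.Ioo (0 : ℝ) 1 \ s, DifferentiableAt ℝ toFun x
  integrable_deriv : IntervalIntegrable (deriv toFun) MeasureTheory.volume 0 1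

/-- The contour integral `∫_c f(z) dz`. -/
def ClosedCurve.integral (c : ClosedCurve) (f : ℂ → ℂ) : ℂ :=
  ∫ x in (0 : ℝ)..1, f (c.toFun x) * deriv c.toFun x

/-- The integral of `f` over a contour consisting of finitely many closed curves. -/
def contourIntegral {m : ℕ} (Γ : Fin m → ClosedCurve) (f : ℂ → ℂ) : ℂ :=
  ∑ j, (Γ j).integral f

/-- `Γ` encloses `σ(A)` in the domain of `g_t`: the curves of `Γ` avoid the imaginary axis (hence
each lies in one of the two open half-planes) and `σ(A)`, and `Γ` winds exactly once, in the
positive direction, around every point of `σ(A)`. -/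
def Encloses {m n : ℕ} (Γ : Fin m → ClosedCurve) (A : Matrix (Fin n) (Fin n) ℂ) : Prop :=
  (∀ j, ∀ x ∈ Set.Icc (0 : ℝ) 1,
    ((Γ j).toFun x).re ≠ 0 ∧ (Γ j).toFun x ∉ spectrum ℂ A) ∧
  ∀ z ∈ spectrum ℂ A,
    (2 * (Real.pi : ℂ) * Complex.I)⁻¹ * contourIntegral Γ (fun w => (w - z)⁻¹) = 1

/-- Green's function of the bounded solutions problem for `x' = A x + f`, computed with the
contour `Γ`: `𝒢(A, t) = (2πi)⁻¹ ∫_Γ g_t(z) (z 1 - A)⁻¹ dz`, the integral being taken entrywise. -/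
def green {m n : ℕ} (Γ : Fin m → ClosedCurve) (A : Matrix (Fin n) (Fin n) ℂ) (t : ℝ) :
    Matrix (Fin n) (Fin n) ℂ :=
  Matrix.of fun i j => (2 * (Real.pi : ℂ) * Complex.I)⁻¹ *
    contourIntegral Γ
      (fun z => gFun t z * ((z • (1 : Matrix (Fin n) (Fin n) ℂ) - A)⁻¹) i j)

/-- The matrix norm induced by the norm `p` on `ℂⁿ`. -/
def opNorm {n : ℕ} (p : Seminorm ℂ (Fin n → ℂ)) (A : Matrix (Fin n) (Fin n) ℂ) : ℝ :=
  sInf {c : ℝ | 0 ≤ c ∧ ∀ x : Fin n → ℂ, p (A.mulVec x) ≤ c * p x}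

/-- The modified Bessel function of the second kind `K_ν(x)`, of real order `ν`, for `x > 0`:
`K_ν(x) = ∫_0^∞ e^{-x cosh u} cosh(νu) du`. -/
def besselK (ν x : ℝ) : ℝ :=
  ∫ u in Set.Ioi (0 : ℝ), Real.exp (-x * Real.cosh u) * Real.cosh (ν * u)

/-- The Heaviside function (never used at `0`). -/
def heaviside (t : ℝ) : ℝ := if 0 < t then 1 else 0

end

end GreenBound

/-! Write G for Green's function of B and G_D(t) = diag(g_t(d_i)) for that of the diagonal part,
where the d_i are the eigenvalues of B. On a generalized eigenvector for an eigenvalue a, the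
contour integral evaluates to g_t(a) times a terminating exponential series. Hence u(t) = G(t)v is
an integrable solution of u' = Bu off 0, with jump v at 0 (`Encloses.hasSolutionPair`).

Treating Nu as a forcing term in u' = Du + Nu gives u = G_D v + G_D * (Nu) off 0. Since N is
strictly triangular, the operator T f = G_D * (N f) satisfies T^n = 0, so u is the finite sum of
T^k(G_D v) over k < n (`Encloses.green_mulVec_eq_sum`). The assumption on diagonal matrices bounds
‖G_D(t)‖ by the scalar h(t), equal to e^{-γ⁻t} for t > 0 and e^{γ⁺t} for t < 0. Therefore ‖T^k(G_D
v)(t)‖ ≤ ‖N‖^k h^{*(k+1)}(t) ‖v‖ (`ofReal_perturb_iterate_le`).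

It remains to compute the convolution power. Off 0, h is γ times the convolution of a decaying
exponential on the positive half-line with one on the negative half-line. Powers of the two factors
are elementary, and for t > 0 their convolution reduces to ∫_0^∞ (s(t+s))^k e^{-γs} ds. The
substitution s = (t/2)(cosh u - 1) turns this into a moment ∫ e^{-z cosh u} sinh^{2k+1} u du with z
= γt/2 (`lintegral_mul_add_pow_exp`), which is K_{k+1/2}(z) up to elementary factors
(`besselK_nat_add_half`). The negative order in the bound is harmless because K_ν is even in ν. -/

namespace GreenBound

open MeasureTheory Set Filter Topology Asymptotics
open scoped ENNReal

/-! ### Integrals over closed curves -/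

section
namespace ClosedCurve

lemma intervalIntegrable_mul_deriv (c : ClosedCurve) {f : ℂ → ℂ}
    (hf : ContinuousOn (fun x => f (c.toFun x)) (Icc 0 1)) :
    IntervalIntegrable (fun x => f (c.toFun x) * deriv c.toFun x) volume 0 1 :=
  c.integrable_deriv.continuousOn_mul (by rwa [uIcc_of_le zero_le_one])

lemma integral_eq_zero_of_hasDerivAt (c : ClosedCurve) {f F : ℂ → ℂ}
    (hF : ∀ x ∈ Icc (0 : ℝ) 1, HasDerivAt F (f (c.toFun x)) (c.toFun x))
    (hf : ContinuousOn (fun x => f (c.toFun x)) (Icc 0 1)) : c.integral f = 0 := by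
  obtain ⟨s, hs, hd⟩ := c.differentiable
  have h := integral_eq_of_hasDerivAt_off_countable_of_le (fun x => F (c.toFun x))
    (fun x => f (c.toFun x) * deriv c.toFun x) zero_le_one hs.countable
    (fun x hx => (hF x hx).continuousAt.comp_continuousWithinAt (c.continuousOn x hx))
    (fun x hx => (hF x (Ioo_subset_Icc_self hx.1)).comp x (hd x hx).hasDerivAt)
    (c.intervalIntegrable_mul_deriv hf)
  rw [integral, h, c.closed, sub_self]

lemma integral_congr (c : ClosedCurve) {f g : ℂ → ℂ}
    (h : ∀ x ∈ Icc (0 : ℝ) 1, f (c.toFun x) = g (c.toFun x)) : c.integral f = c.integral g := by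
  refine intervalIntegral.integral_congr fun x hx => ?_
  rw [uIcc_of_le zero_le_one] at hx
  simp only [h x hx]

lemma integral_const_mul (c : ClosedCurve) (a : ℂ) (f : ℂ → ℂ) :
    c.integral (fun z => a * f z) = a * c.integral f := by
  simp only [integral, mul_assoc, intervalIntegral.integral_const_mul]

lemma integral_add (c : ClosedCurve) {f g : ℂ → ℂ}
    (hf : ContinuousOn (fun x => f (c.toFun x)) (Icc 0 1))
    (hg : ContinuousOn (fun x => g (c.toFun x)) (Icc 0 1)) :
    c.integral (fun z => f z + g z) = c.integral f + c.integral g := by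
  simp only [integral, add_mul]
  exact intervalIntegral.integral_add (c.intervalIntegrable_mul_deriv hf)
    (c.intervalIntegrable_mul_deriv hg)

lemma integral_sum (c : ClosedCurve) {ι : Type*} (s : Finset ι) {f : ι → ℂ → ℂ}
    (hf : ∀ i ∈ s, ContinuousOn (fun x => f i (c.toFun x)) (Icc 0 1)) :
    c.integral (fun z => ∑ i ∈ s, f i z) = ∑ i ∈ s, c.integral (f i) := by
  simp only [integral, Finset.sum_mul]
  exact intervalIntegral.integral_finsetSum fun i hi => c.intervalIntegrable_mul_deriv (hf i hi)

lemma continuousOn_comp (c : ClosedCurve) {f : ℂ → ℂ}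
    (hf : ∀ x ∈ Icc (0 : ℝ) 1, ContinuousAt f (c.toFun x)) :
    ContinuousOn (fun x => f (c.toFun x)) (Icc 0 1) :=
  fun x hx => (hf x hx).comp_continuousWithinAt (c.continuousOn x hx)

/-- The difference quotient of e^{zt} at a is entire, so it has a primitive and integrates to zero
over a closed curve. -/
lemma integral_exp_mul_inv (c : ClosedCurve) {a : ℂ} (ha : ∀ x ∈ Icc (0 : ℝ) 1, c.toFun x ≠ a)
    (t : ℂ) : c.integral (fun z => Complex.exp (z * t) * (z - a)⁻¹) =
      Complex.exp (a * t) * c.integral (fun z => (z - a)⁻¹) := by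
  have hd : Differentiable ℂ (dslope (fun z => Complex.exp (z * t)) a) := by
    intro z
    have : DifferentiableOn ℂ (dslope (fun z => Complex.exp (z * t)) a) univ :=
      (Complex.differentiableOn_dslope univ_mem).2 (by fun_prop)
    exact (this z (mem_univ z)).differentiableAt univ_mem
  obtain ⟨F, hF⟩ := hd.isExactOn_univ
  have h0 := c.integral_eq_zero_of_hasDerivAt (F := F) (fun x _ => hF _ (mem_univ _))
    (c.continuousOn_comp fun x _ => hd.continuous.continuousAt)
  have hinv : ContinuousOn (fun x => (c.toFun x - a)⁻¹) (Icc 0 1) :=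
    (c.continuousOn.sub continuousOn_const).inv₀ fun x hx => sub_ne_zero.2 (ha x hx)
  rw [← integral_const_mul, ← zero_add (c.integral fun z => Complex.exp (a * t) * _), ← h0,
    ← integral_add c (c.continuousOn_comp fun x _ => hd.continuous.continuousAt)
      (f := dslope (fun z => Complex.exp (z * t)) a)
      (g := fun z => Complex.exp (a * t) * (z - a)⁻¹) (continuousOn_const.mul hinv)]
  refine c.integral_congr fun x hx => ?_
  rw [dslope_of_ne _ (ha x hx), slope_def_field]
  ring

lemma integral_exp_mul_inv_pow (c : ClosedCurve) {a : ℂ}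
    (ha : ∀ x ∈ Icc (0 : ℝ) 1, c.toFun x ≠ a) (t : ℂ) (k : ℕ) :
    c.integral (fun z => Complex.exp (z * t) * ((z - a) ^ (k + 1))⁻¹) =
      t ^ k / (k.factorial : ℂ) * Complex.exp (a * t) * c.integral (fun z => (z - a)⁻¹) := by
  induction k with
  | zero => simpa using c.integral_exp_mul_inv ha t
  | succ k ih =>
    have hne : ∀ x ∈ Icc (0 : ℝ) 1, c.toFun x - a ≠ 0 := fun x hx => sub_ne_zero.2 (ha x hx)
    have hcont : ∀ (b : ℂ) (j : ℕ), ContinuousOn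
        (fun x => b * (Complex.exp (c.toFun x * t) * ((c.toFun x - a) ^ j)⁻¹)) (Icc 0 1) := by
      intro b j
      have := c.continuousOn
      refine continuousOn_const.mul (ContinuousOn.mul (by fun_prop) ?_)
      exact ((this.sub continuousOn_const).pow j).inv₀ fun x hx => pow_ne_zero _ (hne x hx)
    -- The integral of the derivative of e^{zt}(z-a)^{-(k+1)} vanishes; this expresses the integral
    -- with exponent k+2 through the one with exponent k+1.
    have h0 := c.integral_eq_zero_of_hasDerivAt
      (F := fun z => Complex.exp (z * t) * ((z - a) ^ (k + 1))⁻¹)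
      (f := fun z => t * (Complex.exp (z * t) * ((z - a) ^ (k + 1))⁻¹) +
        (-(k + 1 : ℂ)) * (Complex.exp (z * t) * ((z - a) ^ (k + 2))⁻¹))
      (fun x hx => by
        have h1 : HasDerivAt (fun z : ℂ => Complex.exp (z * t))
            (Complex.exp (c.toFun x * t) * t) (c.toFun x) := by
          simpa using ((hasDerivAt_id (c.toFun x)).mul_const t).cexp
        have h2 : HasDerivAt (fun z : ℂ => ((z - a) ^ (k + 1))⁻¹) _ (c.toFun x) :=
          ((((hasDerivAt_id (c.toFun x)).sub_const a).pow (k + 1))).inv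
            (pow_ne_zero _ (hne x hx))
        refine (h1.mul h2).congr_deriv ?_
        have := hne x hx
        simp only [id_eq, Pi.pow_apply, Nat.add_sub_cancel]
        push_cast
        field_simp
        ring)
      ((hcont _ _).add (hcont _ _))
    rw [integral_add c (hcont _ _) (hcont _ _), integral_const_mul, integral_const_mul, ih] at h0
    have hk : (k + 1 : ℂ) ≠ 0 := by exact_mod_cast k.succ_ne_zero
    have hk' : (k.factorial : ℂ) ≠ 0 := by exact_mod_cast k.factorial_ne_zero
    rw [Nat.factorial_succ]
    push_cast
    apply mul_left_cancel₀ hk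
    rw [show k + 1 + 1 = k + 2 from rfl]
    rw [neg_mul, ← sub_eq_add_neg, sub_eq_zero] at h0
    rw [← h0]
    generalize c.integral (fun z => (z - a)⁻¹) = I
    field_simp
    ring

lemma re_sign (c : ClosedCurve) (h : ∀ x ∈ Icc (0 : ℝ) 1, (c.toFun x).re ≠ 0) :
    (∀ x ∈ Icc (0 : ℝ) 1, (c.toFun x).re < 0) ∨ ∀ x ∈ Icc (0 : ℝ) 1, 0 < (c.toFun x).re := by
  have hc : ContinuousOn (fun x => (c.toFun x).re) (Icc 0 1) :=
    Complex.continuous_re.comp_continuousOn c.continuousOn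
  by_contra! hcon
  obtain ⟨⟨x, hx, hx'⟩, y, hy, hy'⟩ := hcon
  obtain ⟨z, hz, hz'⟩ := isPreconnected_Icc.intermediate_value hy hx hc ⟨hy', hx'⟩
  exact h z hz hz'

/-- A branch of the logarithm is a primitive on the half-plane containing the curve. -/
lemma integral_inv_eq_zero_of_re_lt (c : ClosedCurve) {a : ℂ}
    (h : ∀ x ∈ Icc (0 : ℝ) 1, a.re < (c.toFun x).re) :
    c.integral (fun z => (z - a)⁻¹) = 0 := by
  have hne : ∀ x ∈ Icc (0 : ℝ) 1, c.toFun x - a ∈ Complex.slitPlane := fun x hx =>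
    Or.inl (by simpa using h x hx)
  refine c.integral_eq_zero_of_hasDerivAt (F := fun z => Complex.log (z - a)) (fun x hx => ?_) ?_
  · simpa using ((hasDerivAt_id (c.toFun x)).sub_const a).clog (hne x hx)
  · exact (c.continuousOn.sub continuousOn_const).inv₀
      fun x hx => Complex.slitPlane_ne_zero (hne x hx)

lemma integral_inv_eq_zero_of_lt_re (c : ClosedCurve) {a : ℂ}
    (h : ∀ x ∈ Icc (0 : ℝ) 1, (c.toFun x).re < a.re) :
    c.integral (fun z => (z - a)⁻¹) = 0 := by
  have hne : ∀ x ∈ Icc (0 : ℝ) 1, a - c.toFun x ∈ Complex.slitPlane := fun x hx =>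
    Or.inl (by simpa using h x hx)
  have hne' : ∀ x ∈ Icc (0 : ℝ) 1, c.toFun x - a ≠ 0 := fun x hx =>
    sub_ne_zero.2 (sub_ne_zero.1 (Complex.slitPlane_ne_zero (hne x hx))).symm
  refine c.integral_eq_zero_of_hasDerivAt (F := fun z => Complex.log (a - z)) (fun x hx => ?_) ?_
  · refine (((hasDerivAt_id (c.toFun x)).const_sub a).clog (hne x hx)).congr_deriv ?_
    simp only [id]
    rw [← neg_sub a, inv_neg, neg_div, one_div]
  · exact (c.continuousOn.sub continuousOn_const).inv₀ hne'

end ClosedCurve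

end

/-! ### Evaluating the contour integral on generalized eigenvectors -/

section
lemma gFun_of_re_neg {z : ℂ} (hz : z.re < 0) (t : ℝ) :
    gFun t z = if 0 < t then Complex.exp (z * t) else 0 := by
  simp [gFun, hz, hz.not_gt, expPlus]

lemma gFun_of_re_pos {z : ℂ} (hz : 0 < z.re) (t : ℝ) :
    gFun t z = if t < 0 then -Complex.exp (z * t) else 0 := by
  simp [gFun, hz, expMinus]

lemma ClosedCurve.continuousOn_gFun (c : ClosedCurve)
    (h : ∀ x ∈ Icc (0 : ℝ) 1, (c.toFun x).re ≠ 0) (t : ℝ) :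
    ContinuousOn (fun x => gFun t (c.toFun x)) (Icc 0 1) := by
  have hc := c.continuousOn
  rcases c.re_sign h with h | h
  · refine ContinuousOn.congr (f := fun x => if 0 < t then Complex.exp (c.toFun x * t) else 0) ?_
      fun x hx => gFun_of_re_neg (h x hx) t
    split_ifs <;> fun_prop
  · refine ContinuousOn.congr (f := fun x => if t < 0 then -Complex.exp (c.toFun x * t) else 0) ?_
      fun x hx => gFun_of_re_pos (h x hx) t
    split_ifs <;> fun_prop

/-- Each curve stays in one half-plane, where g_t is a constant multiple of e^{zt}. If a lies in the
same half-plane, g_t(a) carries the same constant; otherwise the curve does not wind around a and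
both sides vanish. -/
lemma ClosedCurve.integral_gFun_mul_inv_pow (c : ClosedCurve)
    (h : ∀ x ∈ Icc (0 : ℝ) 1, (c.toFun x).re ≠ 0) {a : ℂ} (ha : a.re ≠ 0)
    (hca : ∀ x ∈ Icc (0 : ℝ) 1, c.toFun x ≠ a) (t : ℝ) (k : ℕ) :
    c.integral (fun z => gFun t z * ((z - a) ^ (k + 1))⁻¹) =
      t ^ k / (k.factorial : ℂ) * gFun t a * c.integral (fun z => (z - a)⁻¹) := by
  have key := c.integral_exp_mul_inv_pow hca t k
  rcases c.re_sign h with h | h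
  · rw [c.integral_congr (g := fun z => (if 0 < t then 1 else 0) *
      (Complex.exp (z * t) * ((z - a) ^ (k + 1))⁻¹))
      fun x hx => by rw [gFun_of_re_neg (h x hx)]; split_ifs <;> simp,
      c.integral_const_mul, key]
    rcases ha.lt_or_gt with ha | ha
    · rw [gFun_of_re_neg ha]; split_ifs <;> simp
    · simp [c.integral_inv_eq_zero_of_lt_re fun x hx => (h x hx).trans ha]
  · rw [c.integral_congr (g := fun z => (if t < 0 then -1 else 0) *
      (Complex.exp (z * t) * ((z - a) ^ (k + 1))⁻¹))
      fun x hx => by rw [gFun_of_re_pos (h x hx)]; split_ifs <;> simp,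
      c.integral_const_mul, key]
    rcases ha.lt_or_gt with ha | ha
    · simp [c.integral_inv_eq_zero_of_re_lt fun x hx => ha.trans (h x hx)]
    · rw [gFun_of_re_pos ha]; split_ifs <;> simp

variable {m n : ℕ} {Γ : Fin m → ClosedCurve} {B : Matrix (Fin n) (Fin n) ℂ}

lemma Encloses.contourIntegral_gFun_mul_inv_pow (hΓ : Encloses Γ B) {a : ℂ}
    (ha : a ∈ spectrum ℂ B) (ha0 : a.re ≠ 0) (t : ℝ) (k : ℕ) :
    (2 * (Real.pi : ℂ) * Complex.I)⁻¹ *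
        contourIntegral Γ (fun z => gFun t z * ((z - a) ^ (k + 1))⁻¹) =
      t ^ k / (k.factorial : ℂ) * gFun t a := by
  have h1 : contourIntegral Γ (fun z => gFun t z * ((z - a) ^ (k + 1))⁻¹) =
      t ^ k / (k.factorial : ℂ) * gFun t a * contourIntegral Γ (fun z => (z - a)⁻¹) := by
    rw [contourIntegral, contourIntegral, Finset.mul_sum]
    exact Finset.sum_congr rfl fun j _ => (Γ j).integral_gFun_mul_inv_pow
      (fun x hx => (hΓ.1 j x hx).1) ha0 (fun x hx h => (hΓ.1 j x hx).2 (h ▸ ha)) t k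
  rw [h1, mul_left_comm, hΓ.2 a ha, mul_one]

lemma isUnit_smul_one_sub {z : ℂ} (hz : z ∉ spectrum ℂ B) :
    IsUnit (z • (1 : Matrix (Fin n) (Fin n) ℂ) - B) := by
  rw [spectrum.notMem_iff, Algebra.algebraMap_eq_smul_one] at hz
  exact hz

lemma continuousAt_resolvent_apply {z : ℂ} (hz : z ∉ spectrum ℂ B) (i j : Fin n) :
    ContinuousAt (fun z : ℂ => ((z • (1 : Matrix (Fin n) (Fin n) ℂ) - B)⁻¹) i j) z := by
  have hdet : (z • (1 : Matrix (Fin n) (Fin n) ℂ) - B).det ≠ 0 :=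
    ((Matrix.isUnit_iff_isUnit_det _).1 (isUnit_smul_one_sub hz)).ne_zero
  have h1 : Continuous fun z : ℂ => z • (1 : Matrix (Fin n) (Fin n) ℂ) - B := by fun_prop
  simp only [Matrix.inv_def, Matrix.smul_apply, Ring.inverse_eq_inv', smul_eq_mul]
  refine ContinuousAt.mul ?_ ?_
  · exact (h1.matrix_det.continuousAt).inv₀ hdet
  · exact (h1.matrix_adjugate.matrix_elem i j).continuousAt

/-- With M = B - a, the Neumann series in M/(z - a) terminates on v. Applying (z - a) - M to it
telescopes. -/
lemma resolvent_mulVec_of_pow_mulVec_eq_zero {z a : ℂ} (hz : z ∉ spectrum ℂ B) (hza : z ≠ a)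
    {r : ℕ} {v : Fin n → ℂ} (hv : ((B - a • 1) ^ r).mulVec v = 0) :
    ((z • (1 : Matrix (Fin n) (Fin n) ℂ) - B)⁻¹).mulVec v =
      ∑ k ∈ Finset.range r, ((z - a) ^ (k + 1))⁻¹ • ((B - a • 1) ^ k).mulVec v := by
  have hu := isUnit_smul_one_sub hz
  have hs : z - a ≠ 0 := sub_ne_zero.2 hza
  set M := B - a • (1 : Matrix (Fin n) (Fin n) ℂ) with hM
  have key : (z • (1 : Matrix (Fin n) (Fin n) ℂ) - B).mulVec
      (∑ k ∈ Finset.range r, ((z - a) ^ (k + 1))⁻¹ • (M ^ k).mulVec v) = v := by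
    have h1 : z • (1 : Matrix (Fin n) (Fin n) ℂ) - B = (z - a) • 1 - M := by
      rw [hM, sub_smul]; abel
    have h2 : ∀ k ∈ Finset.range r, (z • (1 : Matrix (Fin n) (Fin n) ℂ) - B).mulVec
        (((z - a) ^ (k + 1))⁻¹ • (M ^ k).mulVec v) =
        ((z - a) ^ k)⁻¹ • (M ^ k).mulVec v - ((z - a) ^ (k + 1))⁻¹ • (M ^ (k + 1)).mulVec v := by
      intro k _
      rw [h1, Matrix.sub_mulVec, Matrix.smul_mulVec, Matrix.one_mulVec, Matrix.mulVec_smul,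
        Matrix.mulVec_mulVec, ← pow_succ', smul_smul]
      congr 2
      rw [pow_succ]; field_simp
    rw [Matrix.mulVec_sum, Finset.sum_congr rfl h2, Finset.sum_range_sub', hv]
    simp
  rw [← key, Matrix.mulVec_mulVec, Matrix.nonsing_inv_mul _
    ((Matrix.isUnit_iff_isUnit_det _).1 hu), Matrix.one_mulVec, key]

lemma Encloses.green_mulVec_apply (hΓ : Encloses Γ B) (t : ℝ) (v : Fin n → ℂ) (i : Fin n) :
    (green Γ B t).mulVec v i = (2 * (Real.pi : ℂ) * Complex.I)⁻¹ * contourIntegral Γ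
      (fun z => gFun t z * ((z • (1 : Matrix (Fin n) (Fin n) ℂ) - B)⁻¹).mulVec v i) := by
  have h1 : (green Γ B t).mulVec v i = ∑ j, (2 * (Real.pi : ℂ) * Complex.I)⁻¹ * ∑ c, v j *
      (Γ c).integral (fun z => gFun t z *
        ((z • (1 : Matrix (Fin n) (Fin n) ℂ) - B)⁻¹) i j) := by
    simp only [Matrix.mulVec, dotProduct, green, Matrix.of_apply, contourIntegral]
    refine Finset.sum_congr rfl fun j _ => ?_
    rw [mul_assoc, ← Finset.mul_sum]
    congr 1
    exact mul_comm _ _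
  rw [h1, ← Finset.mul_sum, Finset.sum_comm, contourIntegral]
  congr 1
  refine Finset.sum_congr rfl fun c _ => ?_
  simp only [← (Γ c).integral_const_mul]
  rw [← (Γ c).integral_sum]
  · refine (Γ c).integral_congr fun x _ => ?_
    simp only [Matrix.mulVec, dotProduct, Finset.mul_sum]
    exact Finset.sum_congr rfl fun j _ => by ring
  · intro j _
    refine continuousOn_const.mul
      (((Γ c).continuousOn_gFun (fun x hx => (hΓ.1 c x hx).1) t).mul ?_)
    exact (Γ c).continuousOn_comp fun x hx => continuousAt_resolvent_apply (hΓ.1 c x hx).2 i j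

lemma Encloses.green_mulVec_of_pow_mulVec_eq_zero (hΓ : Encloses Γ B) {a : ℂ}
    (ha : a ∈ spectrum ℂ B) (ha0 : a.re ≠ 0) {r : ℕ} {v : Fin n → ℂ}
    (hv : ((B - a • 1) ^ r).mulVec v = 0) (t : ℝ) :
    (green Γ B t).mulVec v = gFun t a •
      ∑ k ∈ Finset.range r, ((t : ℂ) ^ k / (k.factorial : ℂ)) • ((B - a • 1) ^ k).mulVec v := by
  ext i
  have hne : ∀ c, ∀ x ∈ Icc (0 : ℝ) 1, (Γ c).toFun x ≠ a :=
    fun c x hx h => (hΓ.1 c x hx).2 (h ▸ ha)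
  have h1 : contourIntegral Γ
      (fun z => gFun t z * ((z • (1 : Matrix (Fin n) (Fin n) ℂ) - B)⁻¹).mulVec v i) =
      ∑ k ∈ Finset.range r, ((B - a • 1) ^ k).mulVec v i *
        contourIntegral Γ (fun z => gFun t z * ((z - a) ^ (k + 1))⁻¹) := by
    simp only [contourIntegral, Finset.mul_sum]
    rw [Finset.sum_comm]
    refine Finset.sum_congr rfl fun c _ => ?_
    simp only [← (Γ c).integral_const_mul]
    rw [← (Γ c).integral_sum]
    · refine (Γ c).integral_congr fun x hx => ?_
      rw [resolvent_mulVec_of_pow_mulVec_eq_zero (hΓ.1 c x hx).2 (hne c x hx) hv,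
        Finset.sum_apply, Finset.mul_sum]
      refine Finset.sum_congr rfl fun k _ => ?_
      simp only [Pi.smul_apply, smul_eq_mul]
      ring
    · intro k _
      refine continuousOn_const.mul
        (((Γ c).continuousOn_gFun (fun x hx => (hΓ.1 c x hx).1) t).mul ?_)
      exact (((Γ c).continuousOn.sub continuousOn_const).pow _).inv₀
        fun x hx => pow_ne_zero _ (sub_ne_zero.2 (hne c x hx))
  rw [hΓ.green_mulVec_apply, h1, Finset.mul_sum, Pi.smul_apply, Finset.sum_apply, smul_eq_mul,
    Finset.mul_sum]
  refine Finset.sum_congr rfl fun k _ => ?_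
  rw [mul_left_comm, hΓ.contourIntegral_gFun_mul_inv_pow ha ha0]
  simp only [Pi.smul_apply, smul_eq_mul]
  ring

end

/-! ### Green's function as an integrable solution with a jump -/

section
lemma hasDerivAt_sum_pow_div_factorial_smul {V : Type*} [NormedAddCommGroup V] [NormedSpace ℂ V]
    (w : ℕ → V) (r : ℕ) (t : ℂ) :
    HasDerivAt (fun t : ℂ => ∑ k ∈ Finset.range (r + 1), (t ^ k / (k.factorial : ℂ)) • w k)
      (∑ k ∈ Finset.range r, (t ^ k / (k.factorial : ℂ)) • w (k + 1)) t := by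
  induction r with
  | zero => simpa using hasDerivAt_const t (w 0)
  | succ r ih =>
    simp only [Finset.sum_range_succ _ (r + 1)]
    rw [Finset.sum_range_succ _ r]
    refine ih.add ?_
    have h := (((hasDerivAt_id t).pow (r + 1)).div_const ((r + 1).factorial : ℂ)).smul_const
      (w (r + 1))
    refine h.congr_deriv ?_
    congr 1
    have : (r.factorial : ℂ) ≠ 0 := by exact_mod_cast r.factorial_ne_zero
    have : (r + 1 : ℂ) ≠ 0 := by exact_mod_cast r.succ_ne_zero
    simp only [id, Nat.add_sub_cancel, Nat.factorial_succ]
    push_cast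
    field_simp

lemma integrableOn_Ioi_pow_mul_exp {a : ℂ} (ha : a.re < 0) (k : ℕ) :
    IntegrableOn (fun t : ℝ => Complex.exp (a * t) * (t : ℂ) ^ k) (Ioi 0) := by
  have h := integrableOn_rpow_mul_exp_neg_mul_rpow (p := 1) (s := k) (b := -a.re)
    (by have : (0 : ℝ) ≤ k := k.cast_nonneg
        linarith) one_pos (by linarith)
  refine h.mono' (by fun_prop) ((ae_restrict_iff' measurableSet_Ioi).2 (ae_of_all _ ?_))
  intro t ht
  rw [mem_Ioi] at ht
  rw [norm_mul, norm_pow, Complex.norm_exp, Complex.norm_real, Real.norm_of_nonneg ht.le, mul_comm]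
  simp

variable {m n : ℕ} {Γ : Fin m → ClosedCurve} {B : Matrix (Fin n) (Fin n) ℂ}

/-- `green Γ B · v` is a bounded solution of `x' = B x` off `0`, with jump `v` at `0`. -/
def HasSolutionPair (Γ : Fin m → ClosedCurve) (B : Matrix (Fin n) (Fin n) ℂ) (v : Fin n → ℂ) :
    Prop :=
  ∃ Ep Em : ℝ → Fin n → ℂ, (∀ t, HasDerivAt Ep (B.mulVec (Ep t)) t) ∧
    (∀ t, HasDerivAt Em (B.mulVec (Em t)) t) ∧ Ep 0 - Em 0 = v ∧
    IntegrableOn Ep (Ioi 0) ∧ IntegrableOn Em (Iio 0) ∧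
    (∀ t, 0 < t → (green Γ B t).mulVec v = Ep t) ∧ ∀ t, t < 0 → (green Γ B t).mulVec v = Em t

lemma hasDerivAt_exp_smul_sum {a : ℂ} {r : ℕ} {v : Fin n → ℂ}
    (hv : ((B - a • 1) ^ (r + 1)).mulVec v = 0) (t : ℝ) :
    HasDerivAt (fun t : ℝ => Complex.exp (a * t) • ∑ k ∈ Finset.range (r + 1),
        ((t : ℂ) ^ k / (k.factorial : ℂ)) • ((B - a • 1) ^ k).mulVec v)
      (B.mulVec (Complex.exp (a * t) • ∑ k ∈ Finset.range (r + 1),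
        ((t : ℂ) ^ k / (k.factorial : ℂ)) • ((B - a • 1) ^ k).mulVec v)) t := by
  set M := B - a • (1 : Matrix (Fin n) (Fin n) ℂ) with hM
  have h1 : HasDerivAt (fun t : ℂ => Complex.exp (a * t)) (Complex.exp (a * t) * a) (t : ℂ) := by
    simpa using ((hasDerivAt_id (t : ℂ)).const_mul a).cexp
  have h2 := hasDerivAt_sum_pow_div_factorial_smul (fun k => (M ^ k).mulVec v) r (t : ℂ)
  refine ((h1.smul h2).scomp t Complex.ofRealCLM.hasDerivAt).congr_deriv ?_
  -- Both M and differentiation shift the index by one; the top term is lost because M^(r+1) kills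
  -- v.
  have h3 : M.mulVec (∑ k ∈ Finset.range (r + 1),
      ((t : ℂ) ^ k / (k.factorial : ℂ)) • (M ^ k).mulVec v) =
      ∑ k ∈ Finset.range r, ((t : ℂ) ^ k / (k.factorial : ℂ)) • (M ^ (k + 1)).mulVec v := by
    simp only [Matrix.mulVec_sum, Matrix.mulVec_smul, Matrix.mulVec_mulVec, ← pow_succ']
    rw [Finset.sum_range_succ, hv]
    simp
  rw [← h3, show B = M + a • (1 : Matrix (Fin n) (Fin n) ℂ) by rw [hM]; abel]
  simp only [Matrix.mulVec_smul, Matrix.add_mulVec, Matrix.smul_mulVec, Matrix.one_mulVec,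
    smul_add, smul_smul, Complex.ofRealCLM_apply, Complex.ofReal_one, one_mul]

lemma integrableOn_Ioi_exp_smul_sum {a : ℂ} (ha : a.re < 0) (r : ℕ) (w : ℕ → Fin n → ℂ) :
    IntegrableOn (fun t : ℝ => Complex.exp (a * t) • ∑ k ∈ Finset.range r,
        ((t : ℂ) ^ k / (k.factorial : ℂ)) • w k) (Ioi 0) := by
  simp only [Finset.smul_sum, smul_smul]
  refine integrable_finsetSum _ fun k _ => ?_
  refine Integrable.smul_const ?_ _
  simp only [← mul_div_assoc]
  exact (integrableOn_Ioi_pow_mul_exp ha k).div_const _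

lemma integrableOn_Iio_exp_smul_sum {a : ℂ} (ha : 0 < a.re) (r : ℕ) (w : ℕ → Fin n → ℂ) :
    IntegrableOn (fun t : ℝ => Complex.exp (a * t) • ∑ k ∈ Finset.range r,
        ((t : ℂ) ^ k / (k.factorial : ℂ)) • w k) (Iio 0) := by
  have h := integrableOn_Ioi_exp_smul_sum (a := -a) (by simpa using ha) r
    (fun k => (-1 : ℂ) ^ k • w k)
  rw [← neg_zero] at h
  refine h.comp_neg_Iio.congr_fun (fun t _ => ?_) measurableSet_Iio
  simp only [Complex.ofReal_neg, neg_mul_neg, smul_smul, neg_pow (t : ℂ)]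
  congr 1
  refine Finset.sum_congr rfl fun k _ => ?_
  rw [div_mul_eq_mul_div, mul_right_comm, ← mul_pow]
  simp

lemma Encloses.hasSolutionPair_of_pow_mulVec_eq_zero (hΓ : Encloses Γ B) {a : ℂ}
    (ha : a ∈ spectrum ℂ B) (ha0 : a.re ≠ 0) {r : ℕ} {v : Fin n → ℂ}
    (hv : ((B - a • 1) ^ (r + 1)).mulVec v = 0) : HasSolutionPair Γ B v := by
  have hd := hasDerivAt_exp_smul_sum hv
  have hg := hΓ.green_mulVec_of_pow_mulVec_eq_zero ha ha0 hv
  have h00 : (Complex.exp (a * (0 : ℝ)) • ∑ k ∈ Finset.range (r + 1),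
      (((0 : ℝ) : ℂ) ^ k / (k.factorial : ℂ)) • ((B - a • 1) ^ k).mulVec v) = v := by
    rw [Finset.sum_range_succ']
    simp
  rcases ha0.lt_or_gt with h0 | h0
  · refine ⟨_, fun _ => 0, hd, ?_, ?_, integrableOn_Ioi_exp_smul_sum h0 _ _, ?_, ?_, ?_⟩
    · intro t; simpa using hasDerivAt_const t (0 : Fin n → ℂ)
    · rw [h00, sub_zero]
    · exact integrableOn_zero
    · intro t ht; rw [hg, gFun_of_re_neg h0, if_pos ht]
    · intro t ht; rw [hg, gFun_of_re_neg h0, if_neg ht.not_gt, zero_smul]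
  -- The solution for t < 0 is -e^{tB}v, so the jump 0 - (-v) is again v.
  · refine ⟨fun _ => 0, fun t => -(Complex.exp (a * t) • ∑ k ∈ Finset.range (r + 1),
      ((t : ℂ) ^ k / (k.factorial : ℂ)) • ((B - a • 1) ^ k).mulVec v), ?_, ?_, ?_, ?_,
      (integrableOn_Iio_exp_smul_sum h0 _ _).neg, ?_, ?_⟩
    · intro t; simpa using hasDerivAt_const t (0 : Fin n → ℂ)
    · intro t
      simp only [Matrix.mulVec_neg]
      exact (hd t).neg
    · beta_reduce
      rw [h00, sub_neg_eq_add, zero_add]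
    · exact integrableOn_zero
    · intro t ht; rw [hg, gFun_of_re_pos h0, if_neg ht.not_gt, zero_smul]
    · intro t ht; rw [hg, gFun_of_re_pos h0, if_pos ht, neg_smul]

/-- The property is additive in v, and ℂⁿ is the sum of the generalized eigenspaces of B; those
outside the spectrum are trivial. -/
lemma Encloses.hasSolutionPair (hΓ : Encloses Γ B) (h0 : ∀ z ∈ spectrum ℂ B, z.re ≠ 0)
    (v : Fin n → ℂ) : HasSolutionPair Γ B v := by
  have hv : v ∈ ⨆ a : ℂ, Module.End.maxGenEigenspace (Matrix.toLin' B) a := by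
    rw [Module.End.iSup_maxGenEigenspace_eq_top]; trivial
  induction hv using Submodule.iSup_induction' with
  | mem a v hv =>
    obtain ⟨r, hr⟩ := (Module.End.mem_maxGenEigenspace _ _ _).1 hv
    have hr' : ((B - a • 1) ^ r).mulVec v = 0 := by
      rw [← Matrix.toLin'_apply, Matrix.toLin'_pow, map_sub, map_smul, Matrix.toLin'_one]
      exact hr
    by_cases ha : a ∈ spectrum ℂ B
    · refine hΓ.hasSolutionPair_of_pow_mulVec_eq_zero ha (h0 a ha) (r := r) ?_
      rw [pow_succ', ← Matrix.mulVec_mulVec, hr', Matrix.mulVec_zero]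
    · have hu : IsUnit ((B - a • (1 : Matrix (Fin n) (Fin n) ℂ)) ^ r) := by
        rw [← neg_sub]
        exact (isUnit_smul_one_sub ha).neg.pow r
      have hv0 : v = 0 := by
        rw [← Matrix.one_mulVec v, ← Matrix.nonsing_inv_mul _
          ((Matrix.isUnit_iff_isUnit_det _).1 hu), ← Matrix.mulVec_mulVec, hr', Matrix.mulVec_zero]
      subst hv0
      exact ⟨fun _ => 0, fun _ => 0, fun t => by simpa using hasDerivAt_const t (0 : Fin n → ℂ),
        fun t => by simpa using hasDerivAt_const t (0 : Fin n → ℂ), by simp, integrableOn_zero,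
        integrableOn_zero, by simp, by simp⟩
  | zero =>
    exact ⟨fun _ => 0, fun _ => 0, fun t => by simpa using hasDerivAt_const t (0 : Fin n → ℂ),
      fun t => by simpa using hasDerivAt_const t (0 : Fin n → ℂ), by simp, integrableOn_zero,
      integrableOn_zero, by simp, by simp⟩
  | add v w _ _ hv hw =>
    obtain ⟨P, M, h1, h2, h3, h4, h5, h6, h7⟩ := hv
    obtain ⟨P', M', h1', h2', h3', h4', h5', h6', h7'⟩ := hw
    refine ⟨P + P', M + M', fun t => ?_, fun t => ?_, ?_, h4.add h4', h5.add h5',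
      fun t ht => ?_, fun t ht => ?_⟩
    · simpa only [Pi.add_apply, Matrix.mulVec_add] using (h1 t).add (h1' t)
    · simpa only [Pi.add_apply, Matrix.mulVec_add] using (h2 t).add (h2' t)
    · rw [← h3, ← h3', Pi.add_apply, Pi.add_apply]; abel
    · rw [Matrix.mulVec_add, h6 t ht, h6' t ht, Pi.add_apply]
    · rw [Matrix.mulVec_add, h7 t ht, h7' t ht, Pi.add_apply]

end

/-! ### Variation of constants and the finite perturbation series -/

section
lemma gFun_neg_neg {z : ℂ} (hz : z.re ≠ 0) (t : ℝ) : gFun (-t) (-z) = -gFun t z := by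
  rcases hz.lt_or_gt with h | h
  · rw [gFun_of_re_neg h, gFun_of_re_pos (by simpa using h)]
    simp only [neg_lt_zero, Complex.ofReal_neg, neg_mul_neg]
    split_ifs <;> simp
  · rw [gFun_of_re_pos h, gFun_of_re_neg (by simpa using h)]
    simp only [neg_pos, Complex.ofReal_neg, neg_mul_neg]
    split_ifs <;> simp

lemma gFun_eq_indicator_of_re_neg {z : ℂ} (hz : z.re < 0) :
    (fun t => gFun t z) = (Ioi (0 : ℝ)).indicator fun t => Complex.exp (z * t) := by
  ext t
  simp [gFun_of_re_neg hz, indicator]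

lemma integrable_gFun {z : ℂ} (hz : z.re ≠ 0) : Integrable (fun t => gFun t z) := by
  have key : ∀ w : ℂ, w.re < 0 → Integrable (fun t => gFun t w) := fun w hw => by
    rw [gFun_eq_indicator_of_re_neg hw, integrable_indicator_iff measurableSet_Ioi]
    simpa using integrableOn_Ioi_pow_mul_exp hw 0
  rcases hz.lt_or_gt with h | h
  · exact key z h
  · refine (key (-z) (by simpa using h)).comp_neg.neg.congr (ae_of_all _ fun t => ?_)
    simp [gFun_neg_neg hz]

lemma norm_gFun_le_one (z : ℂ) (t : ℝ) : ‖gFun t z‖ ≤ 1 := by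
  rcases lt_trichotomy z.re 0 with h | h | h
  · rw [gFun_of_re_neg h]
    split_ifs with ht
    · rw [Complex.norm_exp, Real.exp_le_one_iff]
      simpa using mul_nonpos_of_nonpos_of_nonneg h.le ht.le
    · simp
  · simp [gFun, h]
  · rw [gFun_of_re_pos h]
    split_ifs with ht
    · rw [norm_neg, Complex.norm_exp, Real.exp_le_one_iff]
      simpa using mul_nonpos_of_nonneg_of_nonpos h.le ht.le
    · simp

lemma integrable_mul_gFun {z : ℂ} (hz : z.re ≠ 0) {f : ℝ → ℂ} (hf : Integrable f) (t : ℝ) :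
    Integrable fun s => f s * gFun (t - s) z :=
  hf.mul_bdd ((integrable_gFun hz).comp_sub_left t).aestronglyMeasurable
    (ae_of_all _ fun s => norm_gFun_le_one z (t - s))

/-- The kernel is e^{d(t-s)} on s < t, and f(s)e^{d(t-s)} is the derivative of M(s)e^{d(t-s)} or
P(s)e^{d(t-s)} according to the sign of s. What survives is the value at t and the jump at 0; at -∞
the exponential is at most 1 and M tends to 0. -/
lemma integral_mul_gFun_of_re_neg {d : ℂ} (hd : d.re < 0) {P M f : ℝ → ℂ}
    (hPc : Continuous P) (hMc : Continuous M)
    (hP : ∀ t, 0 < t → HasDerivAt P (d * P t + f t) t)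
    (hM : ∀ t, t < 0 → HasDerivAt M (d * M t + f t) t)
    (hM0 : Tendsto M atBot (𝓝 0)) (hf : Integrable f) {t : ℝ} (ht : t ≠ 0) :
    ∫ s, f s * gFun (t - s) d = (if 0 < t then P t else M t) - gFun t d * (P 0 - M 0) := by
  have hexp : ∀ s : ℝ, HasDerivAt (fun s : ℝ => Complex.exp (d * (t - s)))
      (Complex.exp (d * (t - s)) * -d) s := fun s => by
    have h := (((hasDerivAt_id (s : ℂ)).const_sub (t : ℂ)).const_mul d).cexp.comp_ofReal
    simpa using h
  have hind : (fun s => f s * gFun (t - s) d) =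
      (Iio t).indicator fun s => f s * Complex.exp (d * (t - s)) := by
    ext s
    rw [gFun_of_re_neg hd, indicator_apply]
    simp [mul_ite]
  have hint : IntegrableOn (fun s : ℝ => f s * Complex.exp (d * (t - s))) (Iic t) := by
    rw [integrableOn_Iic_iff_integrableOn_Iio, ← integrable_indicator_iff measurableSet_Iio, ← hind]
    exact integrable_mul_gFun hd.ne hf t
  have hbot : ∀ b ≤ min t 0, ∫ s in Iic b, f s * Complex.exp (d * (t - s)) =
      M b * Complex.exp (d * (t - b)) := by
    intro b hb
    rw [integral_Iic_of_hasDerivAt_of_tendsto (m := 0)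
      (f := fun s : ℝ => M s * Complex.exp (d * (t - s))), sub_zero]
    · exact (hMc.mul (by fun_prop)).continuousWithinAt
    · intro s hs
      refine ((hM s (hs.trans_le (hb.trans (min_le_right _ _)))).mul (hexp s)).congr_deriv ?_
      ring
    · exact hint.mono_set (Iic_subset_Iic.2 (hb.trans (min_le_left _ _)))
    · refine squeeze_zero_norm' ?_ (by simpa using hM0.norm)
      filter_upwards [eventually_le_atBot t] with s hs
      rw [norm_mul, Complex.norm_exp]
      refine mul_le_of_le_one_right (norm_nonneg _) (Real.exp_le_one_iff.2 ?_)
      rw [← Complex.ofReal_sub, Complex.re_mul_ofReal]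
      exact mul_nonpos_of_nonpos_of_nonneg hd.le (sub_nonneg.2 hs)
  rw [hind, integral_indicator measurableSet_Iio, ← integral_Iic_eq_integral_Iio]
  rcases ht.lt_or_gt with h | h
  · rw [hbot t (by simp [h.le]), if_neg h.not_gt, gFun_of_re_neg hd, if_neg h.not_gt]
    simp
  · rw [← Iic_union_Ioc_eq_Iic h.le, setIntegral_union (Iic_disjoint_Ioc le_rfl) measurableSet_Ioc
      (hint.mono_set (Iic_subset_Iic.2 h.le)) (hint.mono_set Ioc_subset_Iic_self),
      hbot 0 (by simp [h.le]), ← intervalIntegral.integral_of_le h.le,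
      intervalIntegral.integral_eq_sub_of_hasDerivAt_of_le h.le
        (f := fun s : ℝ => P s * Complex.exp (d * (t - s))), if_pos h, gFun_of_re_neg hd, if_pos h]
    · simp
      ring
    · exact (hPc.mul (by fun_prop)).continuousOn
    · intro s hs
      refine ((hP s hs.1).mul (hexp s)).congr_deriv ?_
      ring
    · rw [intervalIntegrable_iff_integrableOn_Ioc_of_le h.le]
      exact hint.mono_set Ioc_subset_Iic_self

lemma integral_mul_gFun {d : ℂ} (hd : d.re ≠ 0) {P M f : ℝ → ℂ}
    (hPc : Continuous P) (hMc : Continuous M)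
    (hP : ∀ t, 0 < t → HasDerivAt P (d * P t + f t) t)
    (hM : ∀ t, t < 0 → HasDerivAt M (d * M t + f t) t)
    (hP0 : Tendsto P atTop (𝓝 0)) (hM0 : Tendsto M atBot (𝓝 0)) (hf : Integrable f)
    {t : ℝ} (ht : t ≠ 0) :
    ∫ s, f s * gFun (t - s) d = (if 0 < t then P t else M t) - gFun t d * (P 0 - M 0) := by
  rcases hd.lt_or_gt with h | h
  · exact integral_mul_gFun_of_re_neg h hPc hMc hP hM hM0 hf ht
  -- Time reversal turns d into -d and exchanges the two branches.
  · have h1 := integral_mul_gFun_of_re_neg (d := -d) (P := fun s => M (-s)) (M := fun s => P (-s))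
      (f := fun s => -f (-s)) (by simpa using h) (by fun_prop) (by fun_prop)
      (fun s hs => by
        refine ((hM (-s) (by simpa using hs)).scomp s (hasDerivAt_neg s)).congr_deriv ?_
        simp)
      (fun s hs => by
        refine ((hP (-s) (by simpa using hs)).scomp s (hasDerivAt_neg s)).congr_deriv ?_
        simp)
      (hP0.comp tendsto_neg_atBot_atTop) hf.comp_neg.neg (neg_ne_zero.2 ht)
    rw [← integral_neg_eq_self] at h1
    have h2 : ∀ s, -f (- -s) * gFun (-t - -s) (-d) = f s * gFun (t - s) d := fun s => by
      rw [neg_neg, show -t - -s = -(t - s) by ring, gFun_neg_neg hd]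
      ring
    simp only [h2] at h1
    rw [h1, gFun_neg_neg hd]
    simp only [neg_neg, neg_zero, neg_pos]
    rcases ht.lt_or_gt with h | h
    · rw [if_pos h, if_neg h.not_gt]; ring
    · rw [if_neg h.not_gt, if_pos h]; ring

variable {m n : ℕ} {Γ : Fin m → ClosedCurve}

/-- Convolution of `N f` with Green's function of `x' = diag(d) x`. -/
noncomputable def perturb (d : Fin n → ℂ) (N : Matrix (Fin n) (Fin n) ℂ)
    (f : ℝ → Fin n → ℂ) (t : ℝ) : Fin n → ℂ :=
  fun i => ∫ s, N.mulVec (f s) i * gFun (t - s) (d i)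

variable {d : Fin n → ℂ} {N : Matrix (Fin n) (Fin n) ℂ} {f g : ℝ → Fin n → ℂ}

lemma integrable_mulVec (hf : Integrable f) : Integrable fun s => N.mulVec (f s) :=
  (LinearMap.toContinuousLinearMap N.mulVecLin).integrable_comp hf

lemma integrable_perturb (hd : ∀ i, (d i).re ≠ 0) (hf : Integrable f) :
    Integrable (perturb d N f) := by
  refine Integrable.of_eval fun i => ?_
  exact ((integrable_mulVec (N := N) hf).eval i).integrable_convolution
    (ContinuousLinearMap.mul ℝ ℂ) (integrable_gFun (hd i))

lemma perturb_congr_ae (h : f =ᵐ[volume] g) : perturb d N f = perturb d N g := by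
  ext t i
  refine integral_congr_ae ?_
  filter_upwards [h] with s hs
  rw [hs]

lemma perturb_add (hd : ∀ i, (d i).re ≠ 0) (hf : Integrable f) (hg : Integrable g) :
    perturb d N (f + g) = perturb d N f + perturb d N g := by
  ext t i
  simp only [perturb, Pi.add_apply, Matrix.mulVec_add, add_mul]
  exact integral_add
    (integrable_mul_gFun (hd i) ((integrable_mulVec hf).eval i) t)
    (integrable_mul_gFun (hd i) ((integrable_mulVec hg).eval i) t)

lemma perturb_eq_integral (hd : ∀ i, (d i).re ≠ 0) (hf : Integrable f) (t : ℝ) :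
    perturb d N f t =
      ∫ s, (Matrix.diagonal fun i => gFun (t - s) (d i)).mulVec (N.mulVec (f s)) := by
  ext i
  rw [eval_integral]
  · simp [perturb, Matrix.mulVec_diagonal, mul_comm]
  · intro i
    simpa [Matrix.mulVec_diagonal, mul_comm] using
      integrable_mul_gFun (hd i) ((integrable_mulVec (N := N) hf).eval i) t

/-- Each application makes one more component vanish identically, starting from the last for upper
triangular N and from the first for lower triangular N. -/
lemma perturb_iterate_eq_zero
    (hN : (∀ i j : Fin n, j ≤ i → N i j = 0) ∨ (∀ i j : Fin n, i ≤ j → N i j = 0))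
    (f : ℝ → Fin n → ℂ) : (perturb d N)^[n] f = 0 := by
  rcases hN with hN | hN
  · have key : ∀ (r : ℕ) (t : ℝ) (i : Fin n), n ≤ i + r → (perturb d N)^[r] f t i = 0 := by
      intro r
      induction r with
      | zero => intro t i hi; omega
      | succ r ih =>
        intro t i hi
        rw [Function.iterate_succ_apply']
        refine integral_eq_zero_of_ae (ae_of_all _ fun s => ?_)
        have : N.mulVec ((perturb d N)^[r] f s) i = 0 := by
          rw [Matrix.mulVec, dotProduct]
          refine Finset.sum_eq_zero fun j _ => ?_
          rcases le_or_gt j i with h | h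
          · rw [hN i j h, zero_mul]
          · rw [ih s j (by have : (i : ℕ) < j := h
                           omega), mul_zero]
        simp [this]
    ext t i
    exact key n t i (by omega)
  · have key : ∀ (r : ℕ) (t : ℝ) (i : Fin n), (i : ℕ) < r → (perturb d N)^[r] f t i = 0 := by
      intro r
      induction r with
      | zero => intro t i hi; omega
      | succ r ih =>
        intro t i hi
        rw [Function.iterate_succ_apply']
        refine integral_eq_zero_of_ae (ae_of_all _ fun s => ?_)
        have : N.mulVec ((perturb d N)^[r] f s) i = 0 := by
          rw [Matrix.mulVec, dotProduct]
          refine Finset.sum_eq_zero fun j _ => ?_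
          rcases le_or_gt i j with h | h
          · rw [hN i j h, zero_mul]
          · rw [ih s j (by have : (j : ℕ) < i := h
                           omega), mul_zero]
        simp [this]
    ext t i
    exact key n t i i.2

/-- The free evolution: Green's function of `x' = diag(d) x` applied to `v`. -/
noncomputable def free (d v : Fin n → ℂ) (t : ℝ) : Fin n → ℂ :=
  (Matrix.diagonal fun i => gFun t (d i)).mulVec v

lemma integrable_free (hd : ∀ i, (d i).re ≠ 0) (v : Fin n → ℂ) : Integrable (free d v) := by
  refine Integrable.of_eval fun i => ?_
  simpa [free, Matrix.mulVec_diagonal] using (integrable_gFun (hd i)).mul_const (v i)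

lemma integrable_perturb_iterate (hd : ∀ i, (d i).re ≠ 0) (hf : Integrable f) (r : ℕ) :
    Integrable ((perturb d N)^[r] f) := by
  induction r with
  | zero => exact hf
  | succ r ih => rw [Function.iterate_succ_apply']; exact integrable_perturb hd ih

lemma eq_sum_perturb_iterate (hd : ∀ i, (d i).re ≠ 0) {u : ℝ → Fin n → ℂ} {v : Fin n → ℂ}
    (hN : (∀ i j : Fin n, j ≤ i → N i j = 0) ∨ (∀ i j : Fin n, i ≤ j → N i j = 0))
    (hu : Integrable u) (h : ∀ t, t ≠ 0 → u t = free d v t + perturb d N u t)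
    {t : ℝ} (ht : t ≠ 0) :
    u t = ∑ k ∈ Finset.range n, (perturb d N)^[k] (free d v) t := by
  have hstep : ∀ r : ℕ, ∀ t, t ≠ 0 → (perturb d N)^[r] u t =
      (perturb d N)^[r] (free d v) t + (perturb d N)^[r + 1] u t := by
    intro r
    induction r with
    | zero => exact h
    | succ r ih =>
      intro t _
      -- The equation is known only off t = 0, a null set that the convolution does not see.
      have hae : (perturb d N)^[r] u =ᵐ[volume]
          (perturb d N)^[r] (free d v) + (perturb d N)^[r + 1] u := by
        filter_upwards [compl_mem_ae_iff.2 (measure_singleton (0 : ℝ))] with s hs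
        exact ih s hs
      rw [Function.iterate_succ_apply' _ r u, perturb_congr_ae hae, perturb_add hd
        (integrable_perturb_iterate hd (integrable_free hd v) r)
        (integrable_perturb_iterate hd hu _), Pi.add_apply,
        ← Function.iterate_succ_apply' (perturb d N) r (free d v),
        ← Function.iterate_succ_apply' (perturb d N) (r + 1) u]
  have hsum : ∀ r : ℕ, u t = ∑ k ∈ Finset.range r, (perturb d N)^[k] (free d v) t +
      (perturb d N)^[r] u t := by
    intro r
    induction r with
    | zero => simp
    | succ r ih => rw [ih, Finset.sum_range_succ, hstep r t ht, add_assoc]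
  rw [hsum n, perturb_iterate_eq_zero hN, Pi.zero_apply, add_zero]

lemma Encloses.green_mulVec_eq_sum {B : Matrix (Fin n) (Fin n) ℂ} (hΓ : Encloses Γ B)
    (h0 : ∀ z ∈ spectrum ℂ B, z.re ≠ 0) (hB : B = Matrix.diagonal d + N)
    (hd : ∀ i, (d i).re ≠ 0)
    (hN : (∀ i j : Fin n, j ≤ i → N i j = 0) ∨ (∀ i j : Fin n, i ≤ j → N i j = 0))
    (v : Fin n → ℂ) {t : ℝ} (ht : t ≠ 0) :
    (green Γ B t).mulVec v = ∑ k ∈ Finset.range n, (perturb d N)^[k] (free d v) t := by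
  obtain ⟨P, M, hP, hM, hv, hPi, hMi, hgP, hgM⟩ := hΓ.hasSolutionPair h0 v
  set u : ℝ → Fin n → ℂ := fun t => (green Γ B t).mulVec v with hu
  have hui : Integrable u := by
    rw [← integrableOn_univ, ← Iic_union_Ioi (a := (0 : ℝ)), integrableOn_union,
      integrableOn_Iic_iff_integrableOn_Iio]
    exact ⟨hMi.congr_fun (fun t ht => (hgM t ht).symm) measurableSet_Iio,
      hPi.congr_fun (fun t ht => (hgP t ht).symm) measurableSet_Ioi⟩
  -- An integrable function with integrable derivative tends to zero at infinity; here the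
  -- derivative is B times the function.
  have hP0 : Tendsto P atTop (𝓝 0) := tendsto_zero_of_hasDerivAt_of_integrableOn_Ioi
    (fun x _ => hP x) ((LinearMap.toContinuousLinearMap B.mulVecLin).integrable_comp hPi) hPi
  have hM0 : Tendsto M atBot (𝓝 0) := by
    rw [← integrableOn_Iic_iff_integrableOn_Iio] at hMi
    exact tendsto_zero_of_hasDerivAt_of_integrableOn_Iic
      (fun x _ => hM x) ((LinearMap.toContinuousLinearMap B.mulVecLin).integrable_comp hMi) hMi
  refine eq_sum_perturb_iterate hd hN hui (fun t ht => ?_) ht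
  ext i
  have hBi : ∀ w : Fin n → ℂ, B.mulVec w i = d i * w i + N.mulVec w i := fun w => by
    rw [hB, Matrix.add_mulVec, Pi.add_apply, Matrix.mulVec_diagonal]
  have key := integral_mul_gFun (hd i) (P := fun s => P s i) (M := fun s => M s i)
    (f := fun s => N.mulVec (u s) i)
    ((continuous_apply i).comp (continuous_iff_continuousAt.2 fun s => (hP s).continuousAt))
    ((continuous_apply i).comp (continuous_iff_continuousAt.2 fun s => (hM s).continuousAt))
    (fun s hs => by
      simp only [hu, hgP s hs, ← hBi]
      exact hasDerivAt_pi.1 (hP s) i)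
    (fun s hs => by
      simp only [hu, hgM s hs, ← hBi]
      exact hasDerivAt_pi.1 (hM s) i)
    (tendsto_pi_nhds.1 hP0 i) (tendsto_pi_nhds.1 hM0 i) ((integrable_mulVec hui).eval i) ht
  have hut : u t i = if 0 < t then P t i else M t i := by
    rcases ht.lt_or_gt with h | h
    · rw [if_neg h.not_gt, hu, ← hgM t h]
    · rw [if_pos h, hu, ← hgP t h]
  rw [Pi.add_apply, perturb, key, hut, free, Matrix.mulVec_diagonal, ← hv, Pi.sub_apply]
  ring

end

/-! ### Hyperbolic moments and Bessel functions of half-integer order -/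

section
/-- Continuous functions of at most exponential growth at `+∞`. -/
def ExpGrowth (φ : ℝ → ℝ) : Prop :=
  Continuous φ ∧ ∃ r : ℝ, φ =O[atTop] fun u => Real.exp (r * u)

namespace ExpGrowth

lemma mul {φ ψ : ℝ → ℝ} (hφ : ExpGrowth φ) (hψ : ExpGrowth ψ) :
    ExpGrowth fun u => φ u * ψ u := by
  obtain ⟨r, hr⟩ := hφ.2
  obtain ⟨s, hs⟩ := hψ.2
  refine ⟨hφ.1.mul hψ.1, r + s, (hr.mul hs).congr_right fun u => ?_⟩
  rw [← Real.exp_add, add_mul]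

lemma add {φ ψ : ℝ → ℝ} (hφ : ExpGrowth φ) (hψ : ExpGrowth ψ) :
    ExpGrowth fun u => φ u + ψ u := by
  obtain ⟨r, hr⟩ := hφ.2
  obtain ⟨s, hs⟩ := hψ.2
  have key : ∀ a ≤ max r s, (fun u : ℝ => Real.exp (a * u)) =O[atTop]
      fun u => Real.exp (max r s * u) := fun a ha => by
    refine IsBigO.of_bound' ?_
    filter_upwards [eventually_ge_atTop 0] with u hu
    rw [Real.norm_of_nonneg (by positivity), Real.norm_of_nonneg (by positivity)]
    exact Real.exp_le_exp.2 (mul_le_mul_of_nonneg_right ha hu)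
  exact ⟨hφ.1.add hψ.1, max r s, (hr.trans (key r (le_max_left _ _))).add
    (hs.trans (key s (le_max_right _ _)))⟩

lemma const (a : ℝ) : ExpGrowth fun _ => a :=
  ⟨continuous_const, 0, by simpa using isBigO_const_const a (one_ne_zero (α := ℝ)) atTop⟩

lemma pow {φ : ℝ → ℝ} (hφ : ExpGrowth φ) (k : ℕ) : ExpGrowth fun u => φ u ^ k := by
  induction k with
  | zero => simpa using const 1
  | succ k ih => simpa only [pow_succ] using ih.mul hφ

lemma cosh_mul (ν : ℝ) : ExpGrowth fun u => Real.cosh (ν * u) := by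
  refine ⟨by fun_prop, |ν|, IsBigO.of_bound' ?_⟩
  filter_upwards [eventually_ge_atTop 0] with u hu
  rw [Real.norm_of_nonneg (Real.cosh_pos _).le, Real.norm_of_nonneg (Real.exp_pos _).le,
    ← Real.cosh_abs, abs_mul, abs_of_nonneg hu, Real.cosh_eq]
  have : Real.exp (-(|ν| * u)) ≤ Real.exp (|ν| * u) :=
    Real.exp_le_exp.2 (neg_le_self (by positivity))
  linarith

lemma sinh_mul (ν : ℝ) : ExpGrowth fun u => Real.sinh (ν * u) := by
  obtain ⟨r, hr⟩ := (cosh_mul ν).2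
  refine ⟨by fun_prop, r, IsBigO.trans (IsBigO.of_bound' ?_) hr⟩
  refine Eventually.of_forall fun u => ?_
  rw [Real.norm_eq_abs, Real.norm_of_nonneg (Real.cosh_pos _).le]
  refine abs_le_of_sq_le_sq ?_ (Real.cosh_pos _).le
  linarith [Real.cosh_sq (ν * u)]

lemma cosh : ExpGrowth Real.cosh := by simpa using cosh_mul 1

lemma sinh : ExpGrowth Real.sinh := by simpa using sinh_mul 1

variable {φ φ' : ℝ → ℝ} {z : ℝ}

lemma exp_mul_isBigO (hφ : ExpGrowth φ) (hz : 0 < z) :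
    (fun u => Real.exp (-z * Real.cosh u) * φ u) =O[atTop] fun u => Real.exp (-1 * u) := by
  obtain ⟨r, hr⟩ := hφ.2
  -- Since cosh u ≥ e^u/2, the weight beats any power of e^u. The extra unit in r + 1 leaves a
  -- factor e^{-u} after the growth e^{ru} is absorbed.
  have h1 : Tendsto (fun u : ℝ => Real.exp u ^ (r + 1) * Real.exp (-(z / 2) * Real.exp u))
      atTop (𝓝 0) :=
    (tendsto_rpow_mul_exp_neg_mul_atTop_nhds_zero (r + 1) (z / 2) (by positivity)).comp
      Real.tendsto_exp_atTop
  have h2 : (fun u => Real.exp (-z * Real.cosh u) * Real.exp ((r + 1) * u)) =O[atTop]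
      fun _ => (1 : ℝ) := by
    refine IsBigO.trans (IsBigO.of_bound' (Eventually.of_forall fun u => ?_)) (h1.isBigO_one ℝ)
    rw [Real.norm_of_nonneg (by positivity), Real.norm_of_nonneg (by positivity),
      ← Real.exp_mul, mul_comm u, mul_comm]
    refine mul_le_mul_of_nonneg_left (Real.exp_le_exp.2 ?_) (by positivity)
    rw [Real.cosh_eq]
    nlinarith [Real.exp_pos (-u)]
  have h3 := (hr.mul (h2.mul (isBigO_refl (fun u => Real.exp (-(r + 1) * u)) atTop)))
  refine (IsBigO.congr h3 (fun u => ?_) fun u => ?_)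
  · rw [mul_assoc, ← Real.exp_add, mul_comm, ← add_mul, add_neg_cancel, zero_mul, Real.exp_zero,
      mul_one]
  · rw [one_mul, ← Real.exp_add]
    ring_nf

lemma integrableOn (hφ : ExpGrowth φ) (hz : 0 < z) :
    IntegrableOn (fun u => Real.exp (-z * Real.cosh u) * φ u) (Ioi 0) := by
  have := hφ.1
  exact integrable_of_isBigO_exp_neg one_pos (by fun_prop) (hφ.exp_mul_isBigO hz)

lemma tendsto_exp_mul (hφ : ExpGrowth φ) (hz : 0 < z) :
    Tendsto (fun u => Real.exp (-z * Real.cosh u) * φ u) atTop (𝓝 0) := by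
  refine (hφ.exp_mul_isBigO hz).trans_tendsto ?_
  simpa using Real.tendsto_exp_neg_atTop_nhds_zero

/-- Integration by parts against e^{-z cosh u}, the source of all the recurrences below. -/
lemma integral_exp_mul_deriv (hφ : ExpGrowth φ) (hφ' : ExpGrowth φ')
    (hd : ∀ u, HasDerivAt φ (φ' u) u) (hz : 0 < z) :
    ∫ u in Ioi 0, Real.exp (-z * Real.cosh u) * φ' u =
      z * (∫ u in Ioi 0, Real.exp (-z * Real.cosh u) * (Real.sinh u * φ u)) -
        Real.exp (-z) * φ 0 := by
  have hi := hφ'.integrableOn hz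
  have hi2 := ((ExpGrowth.sinh.mul hφ).integrableOn hz).const_mul (-z)
  have h := integral_Ioi_of_hasDerivAt_of_tendsto' (a := 0) (m := 0)
    (f := fun u => Real.exp (-z * Real.cosh u) * φ u)
    (f' := fun u => Real.exp (-z * Real.cosh u) * φ' u +
      -z * (Real.exp (-z * Real.cosh u) * (Real.sinh u * φ u)))
    (fun u _ => by
      refine ((((Real.hasDerivAt_cosh u).const_mul (-z)).exp).mul (hd u)).congr_deriv ?_
      ring) (hi.add hi2) (hφ.tendsto_exp_mul hz)
  rw [integral_add hi hi2, integral_const_mul] at h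
  simp only [Real.cosh_zero, mul_one] at h
  linarith

end ExpGrowth

/-- `∫_0^∞ e^{-z cosh u} sinh^{2k+1} u du`. -/
noncomputable def sinhMoment (k : ℕ) (z : ℝ) : ℝ :=
  ∫ u in Ioi (0 : ℝ), Real.exp (-z * Real.cosh u) * Real.sinh u ^ (2 * k + 1)

lemma sinhMoment_zero {z : ℝ} (hz : 0 < z) : z * sinhMoment 0 z = Real.exp (-z) := by
  have h := (ExpGrowth.const 1).integral_exp_mul_deriv (ExpGrowth.const 0)
    (fun u => hasDerivAt_const u 1) hz
  simp only [mul_zero, integral_zero, mul_one] at h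
  simp only [sinhMoment, mul_zero, zero_add, pow_one]
  linarith

lemma mul_sinhMoment_succ {z : ℝ} (hz : 0 < z) (k : ℕ) :
    z * sinhMoment (k + 1) z = 2 * (k + 1) *
      ∫ u in Ioi (0 : ℝ), Real.exp (-z * Real.cosh u) *
        (Real.sinh u * (Real.sinh u ^ (2 * k) * Real.cosh u)) := by
  have h := (ExpGrowth.sinh.pow (2 * k + 2)).integral_exp_mul_deriv
    (φ' := fun u => 2 * (k + 1) * (Real.sinh u * (Real.sinh u ^ (2 * k) * Real.cosh u)))
    ((ExpGrowth.const _).mul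
      (ExpGrowth.sinh.mul ((ExpGrowth.sinh.pow (2 * k)).mul ExpGrowth.cosh)))
    (fun u => by
      refine ((Real.hasDerivAt_sinh u).pow (2 * k + 2)).congr_deriv ?_
      simp only [show 2 * k + 2 - 1 = 2 * k + 1 from rfl]
      push_cast
      ring) hz
  simp only [mul_left_comm _ (2 * ((k : ℝ) + 1)), integral_const_mul, Real.sinh_zero] at h
  rw [h, sinhMoment]
  simp [← pow_succ', show 2 * (k + 1) + 1 = 2 * k + 2 + 1 by ring]

lemma sinhMoment_one {z : ℝ} (hz : 0 < z) :
    z ^ 2 * sinhMoment 1 z = 2 * (sinhMoment 0 z + Real.exp (-z)) := by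
  have h := ExpGrowth.cosh.integral_exp_mul_deriv ExpGrowth.sinh Real.hasDerivAt_cosh hz
  have h1 := mul_sinhMoment_succ hz 0
  simp only [mul_zero, pow_zero, one_mul, Real.cosh_zero, mul_one, CharP.cast_eq_zero] at h h1
  simp only [sinhMoment, mul_zero, zero_add, pow_one] at h1 ⊢
  rw [pow_two, mul_assoc, h1, h]
  ring

/-- Two integrations by parts, the second with sinh^{2k+2} u · cosh u and cosh² = 1 + sinh². The
boundary terms vanish because sinh 0 = 0, unlike in `sinhMoment_one`. -/
lemma sinhMoment_succ_succ {z : ℝ} (hz : 0 < z) (k : ℕ) :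
    z ^ 2 * sinhMoment (k + 2) z =
      2 * (k + 2) * ((2 * k + 3) * sinhMoment (k + 1) z + 2 * (k + 1) * sinhMoment k z) := by
  have h := ((ExpGrowth.sinh.pow (2 * (k + 1))).mul ExpGrowth.cosh).integral_exp_mul_deriv
    (φ' := fun u => (2 * k + 3) * Real.sinh u ^ (2 * (k + 1) + 1) +
      2 * (k + 1) * Real.sinh u ^ (2 * k + 1))
    (((ExpGrowth.const _).mul (ExpGrowth.sinh.pow (2 * (k + 1) + 1))).add
      ((ExpGrowth.const _).mul (ExpGrowth.sinh.pow (2 * k + 1))))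
    (fun u => by
      refine (((Real.hasDerivAt_sinh u).pow (2 * (k + 1))).mul
        (Real.hasDerivAt_cosh u)).congr_deriv ?_
      simp only [show 2 * (k + 1) - 1 = 2 * k + 1 from rfl, Pi.pow_apply]
      push_cast
      have := Real.cosh_sq u
      linear_combination (2 * (k + 1) * Real.sinh u ^ (2 * k + 1)) * this) hz
  have h1 := mul_sinhMoment_succ hz (k + 1)
  have hi1 := ((ExpGrowth.sinh.pow (2 * (k + 1) + 1)).integrableOn hz).const_mul (2 * k + 3)
  have hi2 := ((ExpGrowth.sinh.pow (2 * k + 1)).integrableOn hz).const_mul (2 * (k + 1))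
  have h3 := integral_add hi1 hi2
  rw [integral_const_mul, integral_const_mul] at h3
  simp only [mul_add (Real.exp _), mul_left_comm (Real.exp _) (2 * (k : ℝ) + 3),
    mul_left_comm (Real.exp _) (2 * ((k : ℝ) + 1))] at h
  rw [h3, Real.sinh_zero, zero_pow (by positivity), zero_mul, mul_zero, sub_zero] at h
  push_cast at h1
  simp only [sinhMoment] at h1 ⊢
  rw [pow_two, mul_assoc, h1, h]
  ring

lemma besselK_neg (ν z : ℝ) : besselK (-ν) z = besselK ν z := by
  simp [besselK, Real.cosh_neg]

/-- The substitution w = sinh(u/2), with cosh u = 1 + 2w², produces a Gaussian integral. -/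
lemma besselK_half {z : ℝ} (hz : 0 < z) :
    besselK (1 / 2) z = Real.sqrt Real.pi * Real.sqrt (z / 2) * sinhMoment 0 z := by
  have h1 : ∫ u in Ioi (0 : ℝ), Real.exp (-z * (1 + 2 * u ^ 2)) =
      Real.exp (-z) * (Real.sqrt (Real.pi / (2 * z)) / 2) := by
    rw [← integral_gaussian_Ioi, ← integral_const_mul]
    refine integral_congr_ae (ae_of_all _ fun u => ?_)
    simp only [← Real.exp_add]
    ring_nf
  have himg : (fun u => Real.sinh (u / 2)) '' Ioi 0 = Ioi 0 := by
    ext y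
    constructor
    · rintro ⟨u, hu, rfl⟩
      exact Real.sinh_pos_iff.2 (half_pos hu)
    · intro hy
      refine ⟨2 * Real.arsinh y, ?_, by simp⟩
      simpa using hy
  have h2 := integral_image_eq_integral_abs_deriv_smul (s := Ioi (0 : ℝ)) measurableSet_Ioi
    (f := fun u => Real.sinh (u / 2)) (f' := fun u => Real.cosh (u / 2) * (1 / 2))
    (fun u _ => ((hasDerivAt_id u).div_const 2).sinh.hasDerivWithinAt)
    (fun a _ b _ h => by simpa using h) (fun u => Real.exp (-z * (1 + 2 * u ^ 2)))
  have h3 : ∀ u : ℝ, |Real.cosh (u / 2) * (1 / 2)| • Real.exp (-z * (1 + 2 * Real.sinh (u / 2) ^ 2))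
      = 1 / 2 * (Real.exp (-z * Real.cosh u) * Real.cosh (1 / 2 * u)) := fun u => by
    have hc : Real.cosh u = 1 + 2 * Real.sinh (u / 2) ^ 2 := by
      conv_lhs => rw [show u = 2 * (u / 2) by ring, Real.cosh_two_mul, Real.cosh_sq]
      ring
    rw [abs_of_pos (mul_pos (Real.cosh_pos _) one_half_pos), hc, smul_eq_mul,
      show 1 / 2 * u = u / 2 by ring]
    ring
  rw [himg, h1] at h2
  simp only [h3, integral_const_mul] at h2
  have h4 : besselK (1 / 2) z = Real.exp (-z) * Real.sqrt (Real.pi / (2 * z)) := by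
    rw [besselK]; linarith
  have h5 : Real.sqrt (Real.pi / (2 * z)) = Real.sqrt Real.pi * Real.sqrt (z / 2) / z := by
    rw [show Real.pi / (2 * z) = Real.pi * (z / 2) / z ^ 2 by field_simp,
      Real.sqrt_div (by positivity), Real.sqrt_sq hz.le, Real.sqrt_mul (by positivity)]
  rw [h4, h5, ← sinhMoment_zero hz]
  field_simp

lemma besselK_add_one {z : ℝ} (hz : 0 < z) (ν : ℝ) :
    besselK (ν + 1) z = besselK (ν - 1) z + 2 * ν / z * besselK ν z := by
  have h := (ExpGrowth.sinh_mul ν).integral_exp_mul_deriv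
    (φ' := fun u => ν * Real.cosh (ν * u)) ((ExpGrowth.const ν).mul (ExpGrowth.cosh_mul ν))
    (fun u => by
      have := ((hasDerivAt_id u).const_mul ν).sinh
      simpa [mul_comm] using this) hz
  have h1 : besselK (ν + 1) z - besselK (ν - 1) z = 2 *
      ∫ u in Ioi (0 : ℝ), Real.exp (-z * Real.cosh u) * (Real.sinh u * Real.sinh (ν * u)) := by
    rw [besselK, besselK, ← integral_sub ((ExpGrowth.cosh_mul _).integrableOn hz)
      ((ExpGrowth.cosh_mul _).integrableOn hz), ← integral_const_mul]
    refine integral_congr_ae (ae_of_all _ fun u => ?_)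
    simp only [add_mul, sub_mul, one_mul, Real.cosh_add, Real.cosh_sub]
    ring
  simp only [mul_left_comm _ ν, integral_const_mul, mul_zero, Real.sinh_zero, sub_zero] at h
  rw [← besselK] at h
  rw [← sub_eq_iff_eq_add', h1, div_mul_eq_mul_div, mul_assoc 2 ν, h]
  field_simp

/-- Both sides obey the same two-step recurrence. The case of order 3/2 comes from order 1/2 because
K_{-1/2} = K_{1/2}. -/
lemma besselK_nat_add_half {z : ℝ} (hz : 0 < z) (k : ℕ) :
    besselK (k + 1 / 2) z = Real.sqrt Real.pi * Real.sqrt (z / 2) * (z / 2) ^ k /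
      (k.factorial : ℝ) * sinhMoment k z := by
  induction k using Nat.twoStepInduction with
  | zero => simpa using besselK_half hz
  | one =>
    have h := besselK_add_one hz (1 / 2)
    rw [show (1 / 2 : ℝ) - 1 = -(1 / 2) by norm_num, besselK_neg, besselK_half hz] at h
    have h1 := sinhMoment_one hz
    rw [← sinhMoment_zero hz] at h1
    rw [Nat.cast_one, add_comm, h]
    have h2 : sinhMoment 1 z = 2 * (sinhMoment 0 z + z * sinhMoment 0 z) / z ^ 2 := by
      rw [eq_div_iff (by positivity), ← h1]; ring
    rw [h2]
    simp
    field_simp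
    ring
  | more k ih1 ih2 =>
    have h := besselK_add_one hz (k + 1 + 1 / 2)
    have h2 : sinhMoment (k + 2) z = 2 * (k + 2) * ((2 * k + 3) * sinhMoment (k + 1) z +
        2 * (k + 1) * sinhMoment k z) / z ^ 2 := by
      rw [eq_div_iff (by positivity), ← sinhMoment_succ_succ hz]; ring
    rw [Nat.factorial_succ] at ih2
    push_cast at ih2 ⊢
    rw [show (k : ℝ) + 2 + 1 / 2 = k + 1 + 1 / 2 + 1 by ring, h,
      show (k : ℝ) + 1 + 1 / 2 - 1 = k + 1 / 2 by ring, ih1, ih2, h2,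
      show k + 2 = k + 1 + 1 from rfl, Nat.factorial_succ, Nat.factorial_succ]
    have : (k.factorial : ℝ) ≠ 0 := by exact_mod_cast k.factorial_ne_zero
    push_cast
    field_simp
    ring

end

/-! ### Convolution powers of the scalar majorant -/

section
/-- `t^k e^{-ct} / k!` on the positive half-line. -/
noncomputable def expPow (k : ℕ) (c : ℝ) : ℝ → ℝ≥0∞ :=
  (Ioi 0).indicator fun t => ENNReal.ofReal (t ^ k / (k.factorial : ℝ) * Real.exp (-c * t))

@[fun_prop]
lemma measurable_expPow (k : ℕ) (c : ℝ) : Measurable (expPow k c) :=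
  Measurable.indicator (by fun_prop) measurableSet_Ioi

lemma expPow_lconvolution (k : ℕ) (c : ℝ) : expPow k c ⋆ₗ expPow 0 c = expPow (k + 1) c := by
  ext t
  rw [lconvolution_def]
  have h1 : ∀ y, expPow k c y * expPow 0 c (-y + t) = (Ioo 0 t).indicator
      (fun y => ENNReal.ofReal (y ^ k / (k.factorial : ℝ) * Real.exp (-c * t))) y := by
    intro y
    by_cases hy : 0 < y
    · by_cases hyt : y < t
      · rw [expPow, expPow, indicator_of_mem (mem_Ioi.2 hy), indicator_of_mem (mem_Ioi.2 (by linarith)),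
          indicator_of_mem (mem_Ioo.2 ⟨hy, hyt⟩), ← ENNReal.ofReal_mul (by positivity)]
        congr 1
        rw [pow_zero, Nat.factorial_zero, Nat.cast_one, div_one, one_mul, mul_assoc,
          ← Real.exp_add]
        ring_nf
      · rw [expPow, expPow, indicator_of_notMem (a := -y + t) (s := Ioi 0)
          (fun h => hyt (by linarith [mem_Ioi.1 h])),
          indicator_of_notMem (fun h => hyt (mem_Ioo.1 h).2), mul_zero]
    · rw [expPow, indicator_of_notMem (by simpa using hy), indicator_of_notMem (by simp [hy]),
        zero_mul]
  simp only [h1]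
  rw [lintegral_indicator measurableSet_Ioo, expPow]
  by_cases ht : 0 < t
  · rw [indicator_of_mem (mem_Ioi.2 ht), restrict_Ioo_eq_restrict_Ioc,
      ← ofReal_integral_eq_lintegral_ofReal, ← intervalIntegral.integral_of_le ht.le,
      intervalIntegral.integral_mul_const, intervalIntegral.integral_div, integral_pow]
    · congr 2
      rw [Nat.factorial_succ]
      push_cast
      rw [zero_pow (by positivity), sub_zero, div_div]
    · exact (Continuous.integrableOn_Icc (by fun_prop)).mono_set Ioc_subset_Icc_self
    · refine (ae_restrict_iff' measurableSet_Ioc).2 (ae_of_all _ fun y hy => ?_)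
      have := hy.1
      positivity
  · rw [indicator_of_notMem (by simpa using ht), Ioo_eq_empty ht]
    simp

lemma lconvolution_comp_neg (f g : ℝ → ℝ≥0∞) (t : ℝ) :
    ((fun s => f (-s)) ⋆ₗ (fun s => g (-s))) t = (f ⋆ₗ g) (-t) := by
  rw [lconvolution_def, lconvolution_def, ← lintegral_neg_eq_self]
  refine lintegral_congr fun y => ?_
  rw [neg_neg]
  congr 2
  ring

/-- The `(k+1)`-fold convolution power of the scalar majorant of Green's function. -/
noncomputable def majorant (k : ℕ) (c c' : ℝ) (t : ℝ) : ℝ≥0∞ :=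
  ENNReal.ofReal (c + c') ^ (k + 1) * (expPow k c ⋆ₗ fun s => expPow k c' (-s)) t

lemma majorant_neg (k : ℕ) (c c' t : ℝ) : majorant k c c' (-t) = majorant k c' c t := by
  rw [majorant, majorant, ← lconvolution_comp_neg, lconvolution_comm, add_comm]
  simp only [neg_neg]

@[fun_prop]
lemma measurable_majorant (k : ℕ) (c c' : ℝ) : Measurable (majorant k c c') := by
  have : Measurable (expPow k c ⋆ₗ fun s => expPow k c' (-s)) :=
    measurable_lconvolution _ (by fun_prop) (by fun_prop)
  exact this.const_mul _

lemma lconvolution_mul_mul_comm {f g f' g' : ℝ → ℝ≥0∞} (hf : Measurable f) (hg : Measurable g)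
    (hf' : Measurable f') (hg' : Measurable g') :
    (f ⋆ₗ g) ⋆ₗ (f' ⋆ₗ g') = (f ⋆ₗ f') ⋆ₗ (g ⋆ₗ g') := by
  rw [← lconvolution_assoc hf hg (measurable_lconvolution _ hf' hg'),
    lconvolution_assoc hg hf' hg', lconvolution_comm (f := g) (g := f'),
    ← lconvolution_assoc hf' hg hg', lconvolution_assoc hf hf' (measurable_lconvolution _ hg hg')]

/-- Each majorant is a convolution of a factor on the positive half-line with one on the negative
half-line. Commutativity and associativity regroup the factors by half-line, and each group is a
convolution of powers. -/
lemma majorant_lconvolution (k : ℕ) (c c' t : ℝ) :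
    ∫⁻ s, majorant k c c' s * majorant 0 c c' (t - s) = majorant (k + 1) c c' t := by
  set b : ℕ → ℝ → ℝ≥0∞ := fun k s => expPow k c' (-s) with hb
  have hbm : ∀ k, Measurable (b k) := fun k => by fun_prop
  have h2 : b k ⋆ₗ b 0 = b (k + 1) := by
    ext s
    rw [hb, lconvolution_comp_neg, expPow_lconvolution]
  have h1 := congrFun (lconvolution_mul_mul_comm (measurable_expPow k c) (hbm k)
    (measurable_expPow 0 c) (hbm 0)) t
  rw [expPow_lconvolution, h2, lconvolution_def] at h1
  rw [majorant, ← h1, ← lintegral_const_mul _ (by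
    have := measurable_lconvolution volume (measurable_expPow k c) (hbm k)
    have := measurable_lconvolution volume (measurable_expPow 0 c) (hbm 0)
    fun_prop)]
  refine lintegral_congr fun s => ?_
  rw [majorant, majorant, show t - s = -s + t by ring]
  ring

/-- The value of the majorant, up to the exponential factor. -/
noncomputable def majorantValue (k : ℕ) (γ t : ℝ) : ℝ :=
  γ ^ (k + 1) / (k.factorial : ℝ) ^ 2 * ((t / 2) ^ (2 * k + 1) *
    (Real.exp (γ * t / 2) * sinhMoment k (γ * t / 2)))

lemma sinhMoment_nonneg (k : ℕ) (z : ℝ) : 0 ≤ sinhMoment k z :=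
  setIntegral_nonneg measurableSet_Ioi fun _ hu =>
    mul_nonneg (Real.exp_pos _).le (pow_nonneg (Real.sinh_nonneg_iff.2 (le_of_lt hu)) _)

lemma majorantValue_nonneg (k : ℕ) {γ t : ℝ} (hγ : 0 ≤ γ) (ht : 0 ≤ t) :
    0 ≤ majorantValue k γ t := by
  have := sinhMoment_nonneg k (γ * t / 2)
  unfold majorantValue
  positivity

/-- Shows that the majorant with k = 0 is, off 0, exactly the bound for the diagonal Green's
function, so the factorization loses nothing. -/
lemma majorantValue_zero {γ t : ℝ} (hγ : 0 < γ) (ht : 0 < t) : majorantValue 0 γ t = 1 := by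
  have h := sinhMoment_zero (z := γ * t / 2) (by positivity)
  have h2 : sinhMoment 0 (γ * t / 2) = Real.exp (-(γ * t / 2)) / (γ * t / 2) := by
    rw [← h]; field_simp
  rw [majorantValue, h2, ← mul_div_assoc (Real.exp _), ← Real.exp_add, add_neg_cancel,
    Real.exp_zero]
  simp
  field_simp

lemma majorantValue_eq_besselK (k : ℕ) {γ t : ℝ} (hγ : 0 < γ) (ht : 0 < t) :
    majorantValue k γ t = t ^ k * Real.sqrt (γ * t) * Real.exp (γ * t / 2) *
      besselK (-(k : ℝ) - 1 / 2) (γ * t / 2) / (Real.sqrt Real.pi * (k.factorial : ℝ)) := by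
  rw [show -(k : ℝ) - 1 / 2 = -(k + 1 / 2) by ring, besselK_neg,
    besselK_nat_add_half (by positivity), majorantValue]
  have h1 : Real.sqrt (γ * t / 2 / 2) = Real.sqrt (γ * t) / 2 := by
    rw [div_div, show (2 : ℝ) * 2 = 2 ^ 2 by norm_num, Real.sqrt_div (by positivity),
      Real.sqrt_sq (by norm_num)]
  have h2 : Real.sqrt (γ * t) * Real.sqrt (γ * t) = γ * t := Real.mul_self_sqrt (by positivity)
  have h3 : Real.sqrt Real.pi ≠ 0 := (Real.sqrt_pos.2 Real.pi_pos).ne'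
  have h4 : (k.factorial : ℝ) ≠ 0 := by exact_mod_cast k.factorial_ne_zero
  rw [h1]
  calc _ = (γ * t) * (γ ^ k * t ^ k * (t ^ k / 4 ^ k)) / 2 / (k.factorial : ℝ) ^ 2 *
        Real.exp (γ * t / 2) * sinhMoment k (γ * t / 2) := by
        rw [div_pow, pow_add _ (2 * k), pow_add (2 : ℝ), pow_mul, pow_mul]
        norm_num
        ring
    _ = (Real.sqrt (γ * t) * Real.sqrt (γ * t)) * (γ ^ k * t ^ k * (t ^ k / 4 ^ k)) / 2 /
        (k.factorial : ℝ) ^ 2 * Real.exp (γ * t / 2) * sinhMoment k (γ * t / 2) := by rw [h2]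
    _ = _ := by
        rw [show γ * t / 2 / 2 = γ * t / 4 by ring, div_pow, mul_pow]
        generalize Real.sqrt (γ * t) = q
        generalize sinhMoment k (γ * t / 2) = S
        field_simp

/-- Substitute s = (t/2)(cosh u - 1), for which s(t + s) = ((t/2) sinh u)². The Jacobian (t/2) sinh
u raises the exponent to 2k + 1. -/
lemma lintegral_mul_add_pow_exp (k : ℕ) {γ t : ℝ} (hγ : 0 < γ) (ht : 0 < t) :
    ∫⁻ s in Ioi 0, ENNReal.ofReal ((s * (t + s)) ^ k * Real.exp (-γ * s)) =
      ENNReal.ofReal ((t / 2) ^ (2 * k + 1) *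
        (Real.exp (γ * t / 2) * sinhMoment k (γ * t / 2))) := by
  have himg : (fun u => t / 2 * (Real.cosh u - 1)) '' Ioi 0 = Ioi 0 := by
    ext y
    constructor
    · rintro ⟨u, hu, rfl⟩
      have : 1 < Real.cosh u := Real.one_lt_cosh.2 (ne_of_gt hu)
      exact mul_pos (half_pos ht) (by linarith)
    · intro hy
      have hy : 0 < y := hy
      refine ⟨Real.arcosh (2 * y / t + 1), ?_, ?_⟩
      · exact Real.arcosh_pos (by linarith [show 0 < 2 * y / t by positivity])
      · beta_reduce
        rw [Real.cosh_arcosh (by linarith [show 0 < 2 * y / t by positivity])]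
        field_simp
        ring
  have hinj : InjOn (fun u => t / 2 * (Real.cosh u - 1)) (Ioi 0) := by
    intro a ha b hb hab
    have h : Real.cosh a = Real.cosh b := by
      have := mul_left_cancel₀ (half_pos ht).ne' hab
      linarith
    exact Real.cosh_strictMonoOn.injOn (mem_Ici.2 (le_of_lt ha)) (mem_Ici.2 (le_of_lt hb)) h
  rw [← himg, lintegral_image_eq_lintegral_abs_deriv_mul measurableSet_Ioi
    (f' := fun u => t / 2 * Real.sinh u)
    (fun u _ => (((Real.hasDerivAt_cosh u).sub_const 1).const_mul _).hasDerivWithinAt) hinj]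
  have hz : 0 < γ * t / 2 := by positivity
  have hi := (ExpGrowth.sinh.pow (2 * k + 1)).integrableOn hz
  rw [sinhMoment, ← integral_const_mul, ← integral_const_mul,
    ofReal_integral_eq_lintegral_ofReal ((hi.const_mul _).const_mul _)]
  · refine setLIntegral_congr_fun measurableSet_Ioi fun u hu => ?_
    have hs : 0 < Real.sinh u := Real.sinh_pos_iff.2 hu
    rw [← ENNReal.ofReal_mul (abs_nonneg _), abs_of_pos (by positivity)]
    congr 1
    have h1 : t / 2 * (Real.cosh u - 1) * (t + t / 2 * (Real.cosh u - 1)) =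
        (t / 2 * Real.sinh u) ^ 2 := by
      linear_combination (t / 2) ^ 2 * Real.cosh_sq u
    have h2 : Real.exp (-γ * (t / 2 * (Real.cosh u - 1))) =
        Real.exp (γ * t / 2) * Real.exp (-(γ * t / 2) * Real.cosh u) := by
      rw [← Real.exp_add]; ring_nf
    rw [h1, h2, ← pow_mul]
    ring
  · refine (ae_restrict_iff' measurableSet_Ioi).2 (ae_of_all _ fun u hu => ?_)
    have hs : 0 < Real.sinh u := Real.sinh_pos_iff.2 hu
    positivity

lemma majorant_of_pos (k : ℕ) {c c' t : ℝ} (hγ : 0 < c + c') (ht : 0 < t) :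
    majorant k c c' t = ENNReal.ofReal (Real.exp (-c * t) * majorantValue k (c + c') t) := by
  have h1 : ∀ s, expPow k c (t + s) * expPow k c' (-(-(t + s) + t)) =
      (Ioi 0).indicator (fun s => ENNReal.ofReal (Real.exp (-c * t) / (k.factorial : ℝ) ^ 2) *
        ENNReal.ofReal ((s * (t + s)) ^ k * Real.exp (-(c + c') * s))) s := by
    intro s
    rw [show -(-(t + s) + t) = s by ring]
    by_cases hs : 0 < s
    · rw [expPow, expPow, indicator_of_mem (mem_Ioi.2 (by positivity)),
        indicator_of_mem (mem_Ioi.2 hs), indicator_of_mem (mem_Ioi.2 hs),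
        ← ENNReal.ofReal_mul (by positivity), ← ENNReal.ofReal_mul (by positivity)]
      congr 1
      rw [show -(c + c') * s = -c * s + -c' * s by ring, Real.exp_add, mul_add, Real.exp_add,
        mul_pow]
      ring
    · rw [expPow, expPow, indicator_of_notMem (a := s) (s := Ioi 0) (by simpa using hs),
        indicator_of_notMem (a := s) (s := Ioi 0) (by simpa using hs), mul_zero]
  -- Shifting the variable by t > 0 leaves s > 0 as the only constraint from the two supports.
  rw [majorant, lconvolution_def, ← lintegral_add_left_eq_self _ t]
  simp only [h1]
  rw [lintegral_indicator measurableSet_Ioi, lintegral_const_mul' _ _ ENNReal.ofReal_ne_top,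
    lintegral_mul_add_pow_exp k hγ ht, ← ENNReal.ofReal_pow hγ.le,
    ← ENNReal.ofReal_mul (by positivity), ← ENNReal.ofReal_mul (by positivity), majorantValue]
  congr 1
  ring

lemma majorant_of_ne_zero (k : ℕ) {c c' t : ℝ} (hγ : 0 < c + c') (ht : t ≠ 0) :
    majorant k c c' t =
      ENNReal.ofReal ((heaviside t * Real.exp (-c * t) + heaviside (-t) * Real.exp (c' * t)) *
        majorantValue k (c + c') |t|) := by
  rcases ht.lt_or_gt with h | h
  · rw [← neg_neg t, majorant_neg, majorant_of_pos k (by linarith) (neg_pos.2 h), neg_neg,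
      abs_of_neg h, heaviside, heaviside, if_neg h.not_gt, if_pos (neg_pos.2 h), add_comm c']
    simp
  · rw [majorant_of_pos k hγ h, abs_of_pos h, heaviside, heaviside, if_pos h,
      if_neg (by simpa using h.le)]
    simp

end

/-! ### Norm estimates and the diagonal entries of B -/

section
-- Realizes p as the norm of a separate space, so that it does not clash with the supremum norm on
-- `Fin n → ℂ`.
lemma exists_norm_eq {V : Type} [AddCommGroup V] [Module ℂ V] (p : Seminorm ℂ V)
    (hp : ∀ x, p x = 0 → x = 0) :
    ∃ (E : Type) (_ : NormedAddCommGroup E) (_ : NormedSpace ℂ E) (e : V ≃ₗ[ℂ] E),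
      ∀ x, p x = ‖e x‖ := by
  let q : AddGroupNorm V := { p.toAddGroupSeminorm with eq_zero_of_map_eq_zero' := hp }
  let i1 : NormedAddCommGroup V := q.toNormedAddCommGroup
  let i2 : NormedSpace ℂ V := { norm_smul_le := fun a x => (map_smul_eq_mul p a x).le }
  exact ⟨V, i1, i2, LinearEquiv.refl ℂ V, fun x => rfl⟩

variable {n : ℕ} {p : Seminorm ℂ (Fin n → ℂ)}

lemma opNorm_nonneg (p : Seminorm ℂ (Fin n → ℂ)) (A : Matrix (Fin n) (Fin n) ℂ) :
    0 ≤ opNorm p A :=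
  Real.sInf_nonneg fun _ hc => hc.1

lemma opNorm_le {A : Matrix (Fin n) (Fin n) ℂ} {C : ℝ} (hC : 0 ≤ C)
    (h : ∀ x, p (A.mulVec x) ≤ C * p x) : opNorm p A ≤ C :=
  csInf_le ⟨0, fun _ hc => hc.1⟩ ⟨hC, h⟩

lemma le_opNorm (hp : ∀ x, p x = 0 → x = 0) (A : Matrix (Fin n) (Fin n) ℂ) (x : Fin n → ℂ) :
    p (A.mulVec x) ≤ opNorm p A * p x := by
  obtain ⟨E, _, _, e, he⟩ := exists_norm_eq p hp
  have : FiniteDimensional ℂ E := e.finiteDimensional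
  rcases (apply_nonneg p x).eq_or_lt with h | h
  · rw [hp x h.symm]; simp
  · rw [← div_le_iff₀ h]
    refine le_csInf ?_ fun c hc => (div_le_iff₀ h).2 (hc.2 x)
    -- The set defining the infimum is nonempty because linear maps in finite dimension are bounded.
    set L := LinearMap.toContinuousLinearMap
      (e.toLinearMap ∘ₗ A.mulVecLin ∘ₗ e.symm.toLinearMap) with hL
    refine ⟨‖L‖, norm_nonneg _, fun y => ?_⟩
    have := L.le_opNorm (e y)
    simpa [hL, he] using this

lemma enorm_integral_le_lintegral {E : Type} [NormedAddCommGroup E] [NormedSpace ℂ E]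
    (e : (Fin n → ℂ) ≃ₗ[ℂ] E) (F : ℝ → Fin n → ℂ) :
    ‖e (∫ s, F s)‖ₑ ≤ ∫⁻ s, ‖e (F s)‖ₑ := by
  have : FiniteDimensional ℂ E := e.finiteDimensional
  rw [show e (∫ s, F s) = ∫ s, e (F s) from (e.toContinuousLinearEquiv.integral_comp_comm F).symm]
  exact enorm_integral_le_lintegral_enorm _

lemma norm_gFun_le {γm γp : ℝ} {z : ℂ} (hz : z.re ≤ -γm ∨ γp ≤ z.re) (hγm : 0 < γm)
    (hγp : 0 < γp) {t : ℝ} (ht : t ≠ 0) :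
    ‖gFun t z‖ ≤ heaviside t * Real.exp (-γm * t) + heaviside (-t) * Real.exp (γp * t) := by
  rcases hz with hz | hz
  · rw [gFun_of_re_neg (by linarith), heaviside, heaviside]
    rcases ht.lt_or_gt with h | h
    · rw [if_neg h.not_gt, norm_zero, if_neg h.not_gt, if_pos (neg_pos.2 h)]
      positivity
    · rw [if_pos h, if_pos h, if_neg (by simpa using h.le), Complex.norm_exp]
      simpa using mul_le_mul_of_nonneg_right hz h.le
  · rw [gFun_of_re_pos (by linarith), heaviside, heaviside]
    rcases ht.lt_or_gt with h | h
    · rw [if_pos h, if_neg h.not_gt, if_pos (neg_pos.2 h), norm_neg, Complex.norm_exp]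
      simpa using mul_le_mul_of_nonpos_right hz h.le
    · rw [if_neg h.not_gt, norm_zero, if_pos h, if_neg (by simpa using h.le)]
      positivity

lemma heaviside_nonneg (t : ℝ) : 0 ≤ heaviside t := by
  unfold heaviside; split_ifs <;> norm_num

lemma ofReal_diagonal_gFun_mulVec_le (hp : ∀ x, p x = 0 → x = 0)
    (hdiag : ∀ d : Fin n → ℂ, opNorm p (Matrix.diagonal d) ≤ ⨆ i, ‖d i‖) {γm γp : ℝ}
    (hγm : 0 < γm) (hγp : 0 < γp) {d : Fin n → ℂ} (hd : ∀ i, (d i).re ≤ -γm ∨ γp ≤ (d i).re)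
    (t : ℝ) (v : Fin n → ℂ) :
    ENNReal.ofReal (p ((Matrix.diagonal fun i => gFun t (d i)).mulVec v)) ≤
      majorant 0 γm γp t * ENNReal.ofReal (p v) := by
  rcases eq_or_ne t 0 with rfl | ht
  -- The bound is needed for every t because it is used under an integral; at t = 0 the kernel takes
  -- the default value 0.
  · have : ∀ i, gFun 0 (d i) = 0 := fun i => by simp [gFun, expMinus, expPlus]
    simp [this]
  · rw [majorant_of_ne_zero 0 (by linarith) ht, majorantValue_zero (by linarith) (abs_pos.2 ht),
      mul_one, ← ENNReal.ofReal_mul (by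
        have := heaviside_nonneg t
        have := heaviside_nonneg (-t)
        positivity)]
    refine ENNReal.ofReal_le_ofReal ((le_opNorm hp _ v).trans
      (mul_le_mul_of_nonneg_right ((hdiag _).trans ?_) (apply_nonneg p v)))
    refine Real.iSup_le (fun i => norm_gFun_le (hd i) hγm hγp ht) ?_
    have := heaviside_nonneg t
    have := heaviside_nonneg (-t)
    positivity

lemma ofReal_perturb_iterate_le (hp : ∀ x, p x = 0 → x = 0)
    (hdiag : ∀ d : Fin n → ℂ, opNorm p (Matrix.diagonal d) ≤ ⨆ i, ‖d i‖) {γm γp : ℝ}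
    (hγm : 0 < γm) (hγp : 0 < γp) {d : Fin n → ℂ} (hd : ∀ i, (d i).re ≤ -γm ∨ γp ≤ (d i).re)
    (N : Matrix (Fin n) (Fin n) ℂ) (v : Fin n → ℂ) (k : ℕ) (t : ℝ) :
    ENNReal.ofReal (p ((perturb d N)^[k] (free d v) t)) ≤
      ENNReal.ofReal (opNorm p N) ^ k * ENNReal.ofReal (p v) * majorant k γm γp t := by
  have hd0 : ∀ i, (d i).re ≠ 0 := fun i => by
    rcases hd i with h | h
    · exact (by linarith : (d i).re < 0).ne
    · exact (by linarith : 0 < (d i).re).ne'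
  induction k generalizing t with
  | zero =>
    rw [pow_zero, one_mul, mul_comm]
    exact ofReal_diagonal_gFun_mulVec_le hp hdiag hγm hγp hd t v
  | succ k ih =>
    obtain ⟨E, _, _, e, he⟩ := exists_norm_eq p hp
    set F := (perturb d N)^[k] (free d v) with hF
    have hFi : Integrable F := integrable_perturb_iterate hd0 (integrable_free hd0 v) k
    rw [Function.iterate_succ_apply', ← hF, perturb_eq_integral hd0 hFi, he, ofReal_norm]
    refine (enorm_integral_le_lintegral e _).trans ?_
    rw [← majorant_lconvolution, ← lintegral_const_mul _ (by fun_prop)]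
    refine lintegral_mono fun s => ?_
    rw [← ofReal_norm, ← he]
    refine (ofReal_diagonal_gFun_mulVec_le hp hdiag hγm hγp hd (t - s) _).trans ?_
    calc majorant 0 γm γp (t - s) * ENNReal.ofReal (p (N.mulVec (F s)))
        ≤ majorant 0 γm γp (t - s) * (ENNReal.ofReal (opNorm p N) * (ENNReal.ofReal (opNorm p N) ^ k
            * ENNReal.ofReal (p v) * majorant k γm γp s)) := by
          gcongr
          refine (ENNReal.ofReal_le_ofReal (le_opNorm hp N (F s))).trans ?_
          rw [ENNReal.ofReal_mul (opNorm_nonneg p N)]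
          gcongr
          exact ih s
      _ = _ := by ring

/-- The determinant of λ - B is the product of the λ - d_j, which vanishes at λ = d_i. This
transfers the spectral gap to the diagonal entries. -/
lemma mem_spectrum_of_isDiag_add_triangular {B D N : Matrix (Fin n) (Fin n) ℂ} (hB : B = D + N)
    (hD : D.IsDiag)
    (hN : (∀ i j : Fin n, j ≤ i → N i j = 0) ∨ (∀ i j : Fin n, i ≤ j → N i j = 0)) (i : Fin n) :
    D i i ∈ spectrum ℂ B := by
  intro h
  rw [spectrum.mem_resolventSet_iff, Algebra.algebraMap_eq_smul_one, Matrix.isUnit_iff_isUnit_det] at h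
  have hdiag : ∀ j, B j j = D j j := fun j => by
    rw [hB, Matrix.add_apply]
    rcases hN with hN | hN <;> simp [hN j j le_rfl]
  have hdet : (D i i • (1 : Matrix (Fin n) (Fin n) ℂ) - B).det = ∏ j, (D i i - D j j) := by
    have key : ∀ j, (D i i • (1 : Matrix (Fin n) (Fin n) ℂ) - B) j j = D i i - D j j := fun j => by
      simp [hdiag]
    rcases hN with hN | hN
    · rw [Matrix.det_of_isUpperTriangular]
      · exact Finset.prod_congr rfl fun j _ => key j
      · intro a b hab
        have hab : b < a := hab
        simp [hB, hD hab.ne', hN a b hab.le, Matrix.one_apply_ne hab.ne']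
    · rw [Matrix.det_of_isLowerTriangular]
      · exact Finset.prod_congr rfl fun j _ => key j
      · intro a b hab
        have hab : a < b := hab
        simp [hB, hD hab.ne, hN a b hab.le, Matrix.one_apply_ne hab.ne]
  rw [hdet, Finset.prod_eq_zero (Finset.mem_univ i) (sub_self _)] at h
  exact not_isUnit_zero h

end

end GreenBound


/-! ### The norm bound for Green's function -/

open GreenBound in
theorem theorem1 (n : ℕ) (B D N : Matrix (Fin n) (Fin n) ℂ)
    (hB : B = D + N) (hD : D.IsDiag)
    (hN : (∀ i j : Fin n, j ≤ i → N i j = 0) ∨ (∀ i j : Fin n, i ≤ j → N i j = 0))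
    (γm γp : ℝ) (hγm : 0 < γm) (hγp : 0 < γp)
    (hσ : Disjoint {z : ℂ | -γm < z.re ∧ z.re < γp} (spectrum ℂ B))
    (p : Seminorm ℂ (Fin n → ℂ)) (hp : ∀ x, p x = 0 → x = 0)
    (hdiag : ∀ d : Fin n → ℂ, opNorm p (Matrix.diagonal d) ≤ ⨆ i, ‖d i‖)
    (m : ℕ) (Γ : Fin m → ClosedCurve) (hΓ : Encloses Γ B)
    (t : ℝ) (ht : t ≠ 0) :
    opNorm p (green Γ B t) ≤
      (heaviside t * Real.exp (-γm * t) + heaviside (-t) * Real.exp (γp * t)) *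
        ∑ k ∈ Finset.range n, opNorm p N ^ k *
          (|t| ^ k * Real.sqrt ((γm + γp) * |t|) * Real.exp ((γm + γp) * |t| / 2) *
              besselK (-(k : ℝ) - 1 / 2) ((γm + γp) * |t| / 2) /
            (Real.sqrt Real.pi * (Nat.factorial k : ℝ))) := by
  have hγ : 0 < γm + γp := by linarith
  have hspec : ∀ z ∈ spectrum ℂ B, z.re ≤ -γm ∨ γp ≤ z.re := fun z hz => by
    by_contra! h
    exact Set.disjoint_left.1 hσ h hz
  have hne : ∀ z : ℂ, z.re ≤ -γm ∨ γp ≤ z.re → z.re ≠ 0 := fun z hz => by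
    rcases hz with h | h
    · exact (by linarith : z.re < 0).ne
    · exact (by linarith : 0 < z.re).ne'
  have hd := fun i => hspec _ (mem_spectrum_of_isDiag_add_triangular hB hD hN i)
  have hB' : B = Matrix.diagonal (fun i => D i i) + N := by
    rw [hB]; congr 1; exact (hD.diagonal_diag).symm
  simp only [← majorantValue_eq_besselK _ hγ (abs_pos.2 ht)]
  set h := heaviside t * Real.exp (-γm * t) + heaviside (-t) * Real.exp (γp * t) with hh
  have h0 : 0 ≤ h := by
    have := heaviside_nonneg t
    have := heaviside_nonneg (-t)
    positivity
  have hval := fun k => majorantValue_nonneg k hγ.le (abs_nonneg t)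
  refine opNorm_le (mul_nonneg h0 (Finset.sum_nonneg fun k _ =>
    mul_nonneg (pow_nonneg (opNorm_nonneg p N) k) (hval k))) fun v => ?_
  rw [hΓ.green_mulVec_eq_sum (fun z hz => hne z (hspec z hz)) hB' (fun i => hne _ (hd i)) hN v ht,
    Finset.mul_sum, Finset.sum_mul]
  refine (Finset.le_sum_of_subadditive p (map_zero p).le (map_add_le_add p) _ _).trans (Finset.sum_le_sum fun k _ => ?_)
  have key := ofReal_perturb_iterate_le hp hdiag hγm hγp hd N v k t
  -- The majorant is finite off 0, so the extended nonnegative estimate becomes a real inequality.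
  rw [majorant_of_ne_zero k hγ ht, ← hh, ← ENNReal.ofReal_pow (opNorm_nonneg p N),
    ← ENNReal.ofReal_mul (pow_nonneg (opNorm_nonneg p N) k),
    ← ENNReal.ofReal_mul (mul_nonneg (pow_nonneg (opNorm_nonneg p N) k) (apply_nonneg p v)),
    ENNReal.ofReal_le_ofReal_iff (mul_nonneg (mul_nonneg (pow_nonneg (opNorm_nonneg p N) k)
      (apply_nonneg p v)) (mul_nonneg h0 (hval k)))] at key
  refine key.trans (le_of_eq ?_)
  ring
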